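/- Let $\mathbb F=\mathbb F_2$ and let $\mathcal A$ be the mod 2 Steenrod algebra, i.e. the associative unital $\mathbb F$-algebra generated by $Sq^i$ ($i>0$, $Sq^0=1$) subject to the Adem relations $Sq^iSq^j=\sum_{k=0}^{\lfloor i/2\rfloor}\binom{j-k-1}{i-2k}Sq^{i+j-k}Sq^k$ for $0<i<2j$. An unstable module is an $\mathbb N$-graded $\mathcal A$-module $M$ (with $Sq^i M^d\subseteq M^{d+i}$) such that $Sq^ix=0$ for $i>|x|$; put $Sq_0x=Sq^{|x|}x$ for homogeneous $x$. Let $F(1)$ be the free unstable module on one generator $\iota_1$ of degree $1$. Let $\mathcal P$ be a symmetric operad in $\mathbb F$-vector spaces and let $\star\in\mathcal P(2)^{\Sigma_2}$ be $\mathcal P$-central, i.e. for every $n\ge 0$ and $\mu\in\mathcal P(n)$ the interchange law $\star(\mu,\mu)=\mu(\star,\dots,\star)\,\sigma_{2n}$ holds, where the permutation $\sigma_{2n}$ of the inputs sends $2i-1$ to $i$ and $2i$ to $n+i$. A $\star$-unstable $\mathcal P$-algebra is a graded $\mathcal P$-algebra that is an unstable module, satisfies the Cartan formula $$Sq^i\mu(x_1,\dots,x_n)=\sum_{i_1+\dots+i_n=i}\mu(Sq^{i_1}x_1,\dots,Sq^{i_n}x_n),$$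 and satisfies $Sq_0x=\star(x,x)$ for all homogeneous $x$. For a graded vector space $V$, let $S(\mathcal P,V)=\bigoplus_{n\ge0}\mathcal P(n)\otimes_{\Sigma_n}V^{\otimes n}$ be the free graded $\mathcal P$-algebra on $V$. For an unstable module $M$, the space $S(\mathcal P,M)$ carries the Steenrod operations given by the Cartan formula, and $K_{\mathcal P}^\star(M)$ denotes the quotient of $S(\mathcal P,M)$ by the smallest $\mathcal P$-ideal that is stable under the Steenrod operations and contains all $Sq_0t+\star(t,t)$, $t\in S(\mathcal P,M)$ homogeneous. Then $K_{\mathcal P}^\star(F(1))$ is a $\star$-unstable $\mathcal P$-algebra with the following properties, where $\iota_1$ also denotes the image of the generator of $F(1)$ in it. 1. As a graded $\mathcal P$-algebra, it is free on the single generator $\iota_1$ of degree $1$: there is an isomorphism of graded $\mathcal P$-algebras $S(\mathcal P,V)\cong K_{\mathcal P}^\star(F(1))$, where $V$ is one-dimensional and concentrated in degree $1$, that sends the generator of $V$ to $\iota_1$. 2. $Sq^0\iota_1=\iota_1$, $Sq^1\iota_1=\star(\iota_1,\iota_1)$, and $Sq^j\iota_1=0$ for $j\ge2$. 3. These values and the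 Cartan formula determine the Steenrod action: every family of linear operators $(Sq'^{\,j})_{j\ge0}$ on $K_{\mathcal P}^\star(F(1))$ that satisfies the Cartan formula and takes the values of (2) on $\iota_1$ is equal to $(Sq^j)_{j\ge0}$. -/

import Mathlib

open scoped TensorProduct DirectSum

noncomputable section

/-- The base field. -/
abbrev F₂ : Type := ZMod 2

/-! ### Descending multilinear maps along surjections -/

namespace MultilinearLift

variable {ι : Type*} [Fintype ι] [DecidableEq ι] {X Y : ι → Type*} {Z : Type*}
  [∀ i, AddCommGroup (X i)] [∀ i, Module F₂ (X i)]
  [∀ i, AddCommGroup (Y i)] [∀ i, Module F₂ (Y i)] [AddCommGroup Z] [Module F₂ Z]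

theorem apply_eq (q : ∀ i, X i →ₗ[F₂] Y i) (f : MultilinearMap F₂ X Z)
    (hf : ∀ x i a, q i a = 0 → f (Function.update x i a) = 0)
    (x x' : ∀ i, X i) (h : ∀ i, q i (x i) = q i (x' i)) : f x = f x' := by
  have key : ∀ s : Finset ι, f (fun i => if i ∈ s then x' i else x i) = f x := by
    intro s
    induction s using Finset.induction_on with
    | empty => simp
    | insert a s ha ih =>
      rw [← ih]
      set y : ∀ i, X i := fun i => if i ∈ s then x' i else x i with hy
      have e1 : (fun i => if i ∈ insert a s then x' i else x i) = Function.update y a (x' a) := by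
        funext i
        by_cases hia : i = a
        · subst hia; simp
        · simp [hy, hia]
      have e2 : f y = f (Function.update y a (x a)) := by
        congr 1
        funext i
        by_cases hia : i = a
        · subst hia; simp [hy, ha]
        · simp [hia]
      rw [e1, e2, ← sub_eq_zero, ← f.map_update_sub]
      exact hf _ _ _ (by rw [map_sub, h a, sub_self])
  have := key Finset.univ
  simpa using this.symm

/-- A multilinear map that vanishes as soon as one argument is in the kernel of `q i` descends
along the surjections `q i`. -/
def lift (q : ∀ i, X i →ₗ[F₂] Y i) (hq : ∀ i, Function.Surjective (q i))
    (f : MultilinearMap F₂ X Z)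
    (hf : ∀ x i a, q i a = 0 → f (Function.update x i a) = 0) : MultilinearMap F₂ Y Z :=
  have h : ∀ y i (c : Y i) (c' : X i), q i c' = c →
      f (fun j => Function.surjInv (hq j) (Function.update y i c j)) =
      f (Function.update (fun j => Function.surjInv (hq j) (y j)) i c') := by
    intro y i c c' hc
    apply apply_eq q f hf
    intro j
    by_cases hj : j = i
    · subst hj; simp [Function.surjInv_eq, hc]
    · simp [hj]
  MultilinearMap.mk' (fun y => f fun i => Function.surjInv (hq i) (y i))
    (fun y i a b => by
      rw [h y i a _ (Function.surjInv_eq (hq i) a), h y i b _ (Function.surjInv_eq (hq i) b),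
        h y i (a + b) _ ((map_add _ _ _).trans (congrArg₂ _ (Function.surjInv_eq (hq i) a)
          (Function.surjInv_eq (hq i) b))), f.map_update_add])
    (fun y i c a => by
      rw [h y i a _ (Function.surjInv_eq (hq i) a),
        h y i (c • a) _ ((map_smul _ _ _).trans (congrArg _ (Function.surjInv_eq (hq i) a))),
        f.map_update_smul])

theorem lift_apply (q : ∀ i, X i →ₗ[F₂] Y i) (hq : ∀ i, Function.Surjective (q i))
    (f : MultilinearMap F₂ X Z)
    (hf : ∀ x i a, q i a = 0 → f (Function.update x i a) = 0) (x : ∀ i, X i) :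
    lift q hq f hf (fun i => q i (x i)) = f x :=
  apply_eq q f hf _ _ fun i => Function.surjInv_eq (hq i) _

end MultilinearLift

/-! ### Operads -/

/-- Concatenation of `n` blocks of sizes `l i j`, first inside each group `i`, then over all `i`,
against concatenation of all the blocks at once. -/
def nestedBlocks {n : ℕ} (k : Fin n → ℕ) (l : ∀ i, Fin (k i) → ℕ) :
    Fin (∑ i, ∑ j, l i j) ≃
      Fin (∑ p : Fin (∑ i, k i), l (finSigmaFinEquiv.symm p).1 (finSigmaFinEquiv.symm p).2) :=
  finSigmaFinEquiv.symm.trans <|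
    (Equiv.sigmaCongrRight fun _ => finSigmaFinEquiv.symm).trans <|
      (Equiv.sigmaAssoc fun i j => Fin (l i j)).symm.trans <|
        (Equiv.sigmaCongrLeft' (β := fun q : (i : Fin n) × Fin (k i) => Fin (l q.1 q.2))
          finSigmaFinEquiv).trans finSigmaFinEquiv

/-- A symmetric operad in `F₂`-vector spaces.

The symmetric group actions are recorded as relabellings of the inputs along bijections
`Fin m ≃ Fin n` (which exist only if `m = n`): `rel e μ` is `μ` with its input number `i` renamed to
`e i`. For `m = n` the usual right action is `μ · σ = rel σ⁻¹ μ`. Allowing `m` and `n` to be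
equal only propositionally saves casts between `obj m` and `obj n`.

`comp k μ ν` is the total composition `μ(ν₁, …, νₙ)`, its inputs being those of `ν₁`, then those of
`ν₂`, and so on. -/
structure SymmOperad where
  obj : ℕ → Type*
  [addCommGroup : ∀ n, AddCommGroup (obj n)]
  [module : ∀ n, Module F₂ (obj n)]
  rel : ∀ {m n : ℕ}, (Fin m ≃ Fin n) → obj m →ₗ[F₂] obj n
  rel_refl : ∀ (n : ℕ) (μ : obj n), rel (Equiv.refl (Fin n)) μ = μ
  rel_trans : ∀ {l m n : ℕ} (e : Fin l ≃ Fin m) (f : Fin m ≃ Fin n) (μ : obj l),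
    rel (e.trans f) μ = rel f (rel e μ)
  one : obj 1
  comp : ∀ {n : ℕ} (k : Fin n → ℕ),
    obj n →ₗ[F₂] MultilinearMap F₂ (fun i => obj (k i)) (obj (∑ i, k i))
  one_comp : ∀ {n : ℕ} (ν : obj n),
    comp (fun _ : Fin 1 => n) one (fun _ => ν) =
      rel ((Equiv.uniqueSigma fun _ : Fin 1 => Fin n).symm.trans finSigmaFinEquiv) ν
  comp_one : ∀ {n : ℕ} (μ : obj n),
    comp (fun _ : Fin n => 1) μ (fun _ => one) =
      rel ((Equiv.sigmaUnique (Fin n) fun _ => Fin 1).symm.trans finSigmaFinEquiv) μ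
  comp_assoc : ∀ {n : ℕ} (k : Fin n → ℕ) (l : ∀ i, Fin (k i) → ℕ) (μ : obj n)
    (ν : ∀ i, obj (k i)) (ξ : ∀ i j, obj (l i j)),
    comp (fun p : Fin (∑ i, k i) => l (finSigmaFinEquiv.symm p).1 (finSigmaFinEquiv.symm p).2)
        (comp k μ ν) (fun p => ξ (finSigmaFinEquiv.symm p).1 (finSigmaFinEquiv.symm p).2) =
      rel (nestedBlocks k l) (comp (fun i => ∑ j, l i j) μ fun i => comp (l i) (ν i) (ξ i))
  comp_rel : ∀ {n : ℕ} (k l : Fin n → ℕ) (e : ∀ i, Fin (k i) ≃ Fin (l i)) (μ : obj n)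
    (ν : ∀ i, obj (k i)),
    comp l μ (fun i => rel (e i) (ν i)) =
      rel (finSigmaFinEquiv.symm.trans ((Equiv.sigmaCongrRight e).trans finSigmaFinEquiv))
        (comp k μ ν)
  rel_comp : ∀ {m n : ℕ} (e : Fin m ≃ Fin n) (k : Fin n → ℕ) (μ : obj m) (ν : ∀ i, obj (k i)),
    comp k (rel e μ) ν =
      rel (finSigmaFinEquiv.symm.trans
        ((Equiv.sigmaCongrLeft (β := fun i => Fin (k i)) e).trans finSigmaFinEquiv))
        (comp (fun i => k (e i)) μ fun i => ν (e i))

attribute [instance] SymmOperad.addCommGroup SymmOperad.module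

namespace SymmOperad

variable (P : SymmOperad)

/-- `⋆ ∈ P(2)` is fixed by the symmetric group. -/
def IsCommutative (star : P.obj 2) : Prop :=
  ∀ σ : Fin 2 ≃ Fin 2, P.rel σ star = star

/-- The shuffle `σ₂ₙ`: the input number `a` of the `i`-th block of size `2` goes to the input number
`i` of the `a`-th block of size `n`. Counting from `1`, it maps `2i - 1` to `i` and `2i` to
`n + i`. -/
def interchange (n : ℕ) : Fin (∑ _i : Fin n, 2) ≃ Fin (∑ _a : Fin 2, n) :=
  finSigmaFinEquiv.symm.trans <|
    (Equiv.sigmaEquivProd (Fin n) (Fin 2)).trans <|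
      (Equiv.prodComm (Fin n) (Fin 2)).trans <|
        (Equiv.sigmaEquivProd (Fin 2) (Fin n)).symm.trans finSigmaFinEquiv

/-- `⋆` is `P`-central: `⋆(μ, μ)` equals `μ(⋆, …, ⋆)` up to the shuffle of the inputs, for every
operation `μ`. -/
def IsCentral (star : P.obj 2) : Prop :=
  ∀ (n : ℕ) (μ : P.obj n),
    P.comp (fun _ : Fin 2 => n) star (fun _ => μ) =
      P.rel (interchange n) (P.comp (fun _ : Fin n => 2) μ fun _ => star)

/-! ### The Schur functor -/

section Schur

variable (V : Type*) [AddCommGroup V] [Module F₂ V]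

/-- The relations `(μ · σ) ⊗ v = μ ⊗ (σ · v)` defining the tensor product over the group ring of
the symmetric group. -/
def coinvariantRelations (n : ℕ) : Submodule F₂ (P.obj n ⊗[F₂] (⨂[F₂] _ : Fin n, V)) :=
  Submodule.span F₂ {t | ∃ (σ : Fin n ≃ Fin n) (μ : P.obj n) (v : Fin n → V),
    t = P.rel σ μ ⊗ₜ PiTensorProduct.tprod F₂ v - μ ⊗ₜ PiTensorProduct.tprod F₂ (v ∘ σ)}

/-- `P(n) ⊗_{Σₙ} V^{⊗n}`. -/
abbrev SchurArity (n : ℕ) :=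
  (P.obj n ⊗[F₂] (⨂[F₂] _ : Fin n, V)) ⧸ P.coinvariantRelations V n

/-- `S(P, V) = ⨁ₙ P(n) ⊗_{Σₙ} V^{⊗n}`. -/
abbrev Schur := ⨁ n, P.SchurArity V n

variable {V}

/-- The element `(μ; v₁, …, vₙ)` of `P(n) ⊗_{Σₙ} V^{⊗n}`. -/
def monoArity {n : ℕ} (μ : P.obj n) (v : Fin n → V) : P.SchurArity V n :=
  (P.coinvariantRelations V n).mkQ (μ ⊗ₜ PiTensorProduct.tprod F₂ v)

/-- The element `(μ; v₁, …, vₙ)` of `S(P, V)`. -/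
def mono {n : ℕ} (μ : P.obj n) (v : Fin n → V) : P.Schur V :=
  DirectSum.lof F₂ ℕ (P.SchurArity V) n (P.monoArity μ v)

theorem monoArity_rel {n : ℕ} (σ : Fin n ≃ Fin n) (μ : P.obj n) (v : Fin n → V) :
    P.monoArity (P.rel σ μ) v = P.monoArity μ (v ∘ σ) := by
  unfold monoArity
  rw [← sub_eq_zero, ← map_sub, Submodule.mkQ_apply, Submodule.Quotient.mk_eq_zero]
  exact Submodule.subset_span ⟨σ, μ, v, rfl⟩

/-- `monoArity`, as a map that is linear in the operation and multilinear in the entries. -/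
def monoArityₗ (V : Type*) [AddCommGroup V] [Module F₂ V] (n : ℕ) :
    P.obj n →ₗ[F₂] MultilinearMap F₂ (fun _ : Fin n => V) (P.SchurArity V n) where
  toFun μ := ((P.coinvariantRelations V n).mkQ ∘ₗ TensorProduct.mk F₂ _ _ μ).compMultilinearMap
    (PiTensorProduct.tprod F₂)
  map_add' μ ν := by ext v; simp
  map_smul' c μ := by
    ext v
    simp only [LinearMap.compMultilinearMap_apply, LinearMap.comp_apply, map_smul,
      LinearMap.smul_apply, RingHom.id_apply, smul_apply]

theorem monoArityₗ_apply {n : ℕ} (μ : P.obj n) (v : Fin n → V) :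
    P.monoArityₗ V n μ v = P.monoArity μ v := rfl

theorem coinvariantRelations_le_ker {n : ℕ} {Z : Type*} [AddCommGroup Z] [Module F₂ Z]
    (g : P.obj n →ₗ[F₂] MultilinearMap F₂ (fun _ : Fin n => V) Z)
    (hg : ∀ (σ : Fin n ≃ Fin n) μ v, g (P.rel σ μ) v = g μ (v ∘ σ)) :
    P.coinvariantRelations V n ≤
      LinearMap.ker (TensorProduct.lift ((PiTensorProduct.lift (R := F₂) (s := fun _ : Fin n => V)
        (E := Z)).toLinearMap ∘ₗ g)) := by
  refine Submodule.span_le.2 ?_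
  rintro _ ⟨σ, μ, v, rfl⟩
  simp [hg]

/-- Linear maps out of `P(n) ⊗_{Σₙ} V^{⊗n}`. -/
def arityLift {n : ℕ} {Z : Type*} [AddCommGroup Z] [Module F₂ Z]
    (g : P.obj n →ₗ[F₂] MultilinearMap F₂ (fun _ : Fin n => V) Z)
    (hg : ∀ (σ : Fin n ≃ Fin n) μ v, g (P.rel σ μ) v = g μ (v ∘ σ)) :
    P.SchurArity V n →ₗ[F₂] Z :=
  (P.coinvariantRelations V n).liftQ
    (TensorProduct.lift ((PiTensorProduct.lift (R := F₂) (s := fun _ : Fin n => V)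
      (E := Z)).toLinearMap ∘ₗ g)) (P.coinvariantRelations_le_ker g hg)

theorem arityLift_mono {n : ℕ} {Z : Type*} [AddCommGroup Z] [Module F₂ Z]
    (g : P.obj n →ₗ[F₂] MultilinearMap F₂ (fun _ : Fin n => V) Z)
    (hg : ∀ (σ : Fin n ≃ Fin n) μ v, g (P.rel σ μ) v = g μ (v ∘ σ)) (μ : P.obj n)
    (v : Fin n → V) : P.arityLift g hg (P.monoArity μ v) = g μ v := by
  simp [arityLift, monoArity]

/-- The presentation of `P(n) ⊗_{Σₙ} V^{⊗n}` by the generators `(μ; v₁, …, vₙ)`. -/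
def generators (V : Type*) [AddCommGroup V] [Module F₂ V] (n : ℕ) :
    (P.obj n × (Fin n → V) →₀ F₂) →ₗ[F₂] P.SchurArity V n :=
  Finsupp.linearCombination F₂ fun x => P.monoArity x.1 x.2

theorem generators_surjective (V : Type*) [AddCommGroup V] [Module F₂ V] (n : ℕ) :
    Function.Surjective (P.generators V n) := by
  rw [← LinearMap.range_eq_top, eq_top_iff]
  rintro x -
  obtain ⟨t, rfl⟩ := (P.coinvariantRelations V n).mkQ_surjective x
  induction t using TensorProduct.induction_on with
  | zero => simp
  | add a b ha hb => rw [map_add]; exact Submodule.add_mem _ ha hb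
  | tmul μ w =>
    induction w using PiTensorProduct.induction_on with
    | smul_tprod r v =>
      rw [TensorProduct.tmul_smul, map_smul]
      refine Submodule.smul_mem _ _ ⟨Finsupp.single (μ, v) 1, ?_⟩
      simp [generators, monoArity]
    | add a b ha hb => rw [TensorProduct.tmul_add, map_add]; exact Submodule.add_mem _ ha hb

/-- Concatenation of blocks of vectors. -/
def concat {W : Type*} {n : ℕ} {k : Fin n → ℕ} (v : ∀ i, Fin (k i) → W) : Fin (∑ i, k i) → W :=
  fun p => v (finSigmaFinEquiv.symm p).1 (finSigmaFinEquiv.symm p).2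

theorem concat_apply {W : Type*} {n : ℕ} {k : Fin n → ℕ} (v : ∀ i, Fin (k i) → W) (i : Fin n)
    (j : Fin (k i)) : concat v (finSigmaFinEquiv ⟨i, j⟩) = v i j := by
  change (fun q : (i : Fin n) × Fin (k i) => v q.1 q.2) (finSigmaFinEquiv.symm _) = _
  rw [Equiv.symm_apply_apply]

theorem concat_update_update {n : ℕ} {k : Fin n → ℕ} (v : ∀ i, Fin (k i) → V) (i : Fin n)
    (w : Fin (k i) → V) (j : Fin (k i)) (a : V) :
    concat (Function.update v i (Function.update w j a)) =
      Function.update (concat (Function.update v i w)) (finSigmaFinEquiv ⟨i, j⟩) a := by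
  funext p
  obtain ⟨⟨i', j'⟩, rfl⟩ := finSigmaFinEquiv.surjective p
  by_cases hi : i' = i
  · subst hi
    by_cases hj : j' = j
    · subst hj; simp [concat_apply]
    · have : (⟨i', j'⟩ : (i : Fin n) × Fin (k i)) ≠ ⟨i', j⟩ := by simpa using hj
      simp [concat_apply, hj]
  · have : (⟨i', j'⟩ : (i : Fin n) × Fin (k i)) ≠ ⟨i, j⟩ := fun h => hi (congrArg Sigma.fst h)
    simp [concat_apply, hi, this]

/-- For fixed `μ`, and fixed `(νⱼ; vⱼ)` for `j ≠ i`, the element `(μ(ν₁, …, νₙ); v₁, …, vₙ)` as a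
function of `(νᵢ; vᵢ)`. -/
def substOne {n : ℕ} (k : Fin n → ℕ) (μ : P.obj n) (ν : ∀ i, P.obj (k i))
    (v : ∀ i, Fin (k i) → V) (i : Fin n) :
    P.obj (k i) →ₗ[F₂] MultilinearMap F₂ (fun _ : Fin (k i) => V) (P.SchurArity V (∑ i, k i)) where
  toFun a := MultilinearMap.mk'
    (fun w => P.monoArityₗ V _ (P.comp k μ (Function.update ν i a)) (concat (Function.update v i w)))
    (fun w j x y => by simp only [concat_update_update, MultilinearMap.map_update_add])
    (fun w j c x => by simp only [concat_update_update, MultilinearMap.map_update_smul])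
  map_add' a b := by ext w; simp
  map_smul' c a := by ext w; simp

theorem substOne_apply {n : ℕ} (k : Fin n → ℕ) (μ : P.obj n) (ν : ∀ i, P.obj (k i))
    (v : ∀ i, Fin (k i) → V) (i : Fin n) (a : P.obj (k i)) (w : Fin (k i) → V) :
    P.substOne k μ ν v i a w =
      P.monoArity (P.comp k μ (Function.update ν i a)) (concat (Function.update v i w)) := rfl

theorem substOne_rel {n : ℕ} (k : Fin n → ℕ) (μ : P.obj n) (ν : ∀ i, P.obj (k i))
    (v : ∀ i, Fin (k i) → V) (i : Fin n) (σ : Fin (k i) ≃ Fin (k i)) (a : P.obj (k i))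
    (w : Fin (k i) → V) :
    P.substOne k μ ν v i (P.rel σ a) w = P.substOne k μ ν v i a (w ∘ σ) := by
  rw [substOne_apply, substOne_apply]
  let e : ∀ j, Fin (k j) ≃ Fin (k j) := Function.update (fun j => Equiv.refl _) i σ
  have h1 : Function.update ν i (P.rel σ a) = fun j => P.rel (e j) (Function.update ν i a j) := by
    funext j
    by_cases hj : j = i
    · subst hj; simp [e]
    · simp [e, hj, P.rel_refl]
  rw [h1, P.comp_rel, monoArity_rel]
  congr 1
  funext p
  obtain ⟨⟨i', j'⟩, rfl⟩ := finSigmaFinEquiv.surjective p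
  by_cases hi : i' = i
  · subst hi
    simp only [Function.comp_apply, Equiv.trans_apply, Equiv.symm_apply_apply,
      Equiv.sigmaCongrRight_apply, concat_apply, e, Function.update_self]
  · simp only [Function.comp_apply, Equiv.trans_apply, Equiv.symm_apply_apply,
      Equiv.sigmaCongrRight_apply, concat_apply, e, Function.update_of_ne hi,
      Equiv.refl_apply]

/-- The composition `(μ; (ν₁; v₁), …, (νₙ; vₙ)) ↦ (μ(ν₁, …, νₙ); v₁, …, vₙ)` on formal sums of
generators of arities `k₁, …, kₙ`. -/
def opFormal {n : ℕ} (k : Fin n → ℕ) (μ : P.obj n) :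
    MultilinearMap F₂ (fun i => (P.obj (k i) × (Fin (k i) → V)) →₀ F₂)
      (P.SchurArity V (∑ i, k i)) :=
  letI : ∀ i, DecidableEq (P.obj (k i) × (Fin (k i) → V)) := fun _ => Classical.decEq _
  ((Finsupp.linearCombination F₂ fun x : ∀ i, P.obj (k i) × (Fin (k i) → V) =>
      P.monoArity (P.comp k μ fun i => (x i).1) (concat fun i => (x i).2)) ∘ₗ
    (PiTensorProduct.ofFinsuppEquiv' (R := F₂)).toLinearMap).compMultilinearMap
    (PiTensorProduct.tprod F₂)

theorem opFormal_single {n : ℕ} (k : Fin n → ℕ) (μ : P.obj n)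
    (x : ∀ i, P.obj (k i) × (Fin (k i) → V)) :
    P.opFormal k μ (fun i => Finsupp.single (x i) 1) =
      P.monoArity (P.comp k μ fun i => (x i).1) (concat fun i => (x i).2) := by
  simp [opFormal]

theorem opFormal_update {n : ℕ} (k : Fin n → ℕ) (μ : P.obj n)
    (x : ∀ i, (P.obj (k i) × (Fin (k i) → V)) →₀ F₂) (i : Fin n)
    (a : (P.obj (k i) × (Fin (k i) → V)) →₀ F₂) (ha : P.generators V (k i) a = 0) :
    P.opFormal k μ (Function.update x i a) = 0 := by
  suffices h : ∀ s : Finset (Fin n), ∀ x : ∀ i, (P.obj (k i) × (Fin (k i) → V)) →₀ F₂,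
      (∀ j, j ∉ s → ∃ y, x j = Finsupp.single y 1) →
      P.opFormal k μ (Function.update x i a) = 0 from h Finset.univ x (by simp)
  intro s
  induction s using Finset.induction_on with
  | empty =>
    intro x hx
    choose y hy using fun j => hx j (by simp)
    obtain rfl : x = fun j => Finsupp.single (y j) 1 := funext hy
    have key : (P.opFormal k μ).toLinearMap (fun j => Finsupp.single (y j) 1) i =
        P.arityLift (P.substOne k μ (fun j => (y j).1) (fun j => (y j).2) i)
          (P.substOne_rel k μ _ _ i) ∘ₗ P.generators V (k i) := by
      ext z
      have : Function.update (fun j => Finsupp.single (y j) (1 : F₂)) i (Finsupp.single z 1) =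
          fun j => Finsupp.single (Function.update y i z j) 1 := by
        funext j
        by_cases hj : j = i
        · subst hj; simp
        · simp [hj]
      simp only [LinearMap.comp_apply, Finsupp.lsingle_apply, MultilinearMap.toLinearMap_apply,
        generators, Finsupp.linearCombination_single, one_smul, arityLift_mono, substOne_apply]
      rw [this, opFormal_single]
      congr 2
      · funext j
        by_cases hj : j = i
        · subst hj; simp
        · simp [hj]
      · funext j
        by_cases hj : j = i
        · subst hj; simp
        · simp [hj]
    have := LinearMap.congr_fun key a
    simpa [ha] using this
  | insert b s hb ih =>
    intro x hx
    by_cases hbi : b = i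
    · have : Function.update x i a =
          Function.update (Function.update x i (Finsupp.single (0, 0) 1)) i a := by simp
      rw [this]
      apply ih
      intro j hj
      by_cases hji : j = i
      · subst hji; exact ⟨(0, 0), by simp⟩
      · rw [Function.update_of_ne hji]
        exact hx j (by simp [hj, hbi, hji])
    · have hxb : ∀ c, P.opFormal k μ (Function.update (Function.update x i a) b c) = 0 := by
        intro c
        induction c using Finsupp.induction_linear with
        | zero => simp
        | add c d hc hd => rw [MultilinearMap.map_update_add, hc, hd, add_zero]
        | single z r =>
          have : Finsupp.single z r = r • Finsupp.single z (1 : F₂) := by simp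
          rw [this, MultilinearMap.map_update_smul, Function.update_comm (Ne.symm hbi), ih,
            smul_zero]
          intro j hj
          by_cases hjb : j = b
          · subst hjb; exact ⟨z, by simp⟩
          · rw [Function.update_of_ne hjb]
            exact hx j (by simp [hj, hjb])
      have := hxb (x b)
      rwa [Function.update_comm (Ne.symm hbi), Function.update_eq_self] at this

/-- The composition on the components of arities `k₁, …, kₙ` of `S(P, V)`. -/
def opArity {n : ℕ} (k : Fin n → ℕ) (μ : P.obj n) :
    MultilinearMap F₂ (fun i => P.SchurArity V (k i)) (P.SchurArity V (∑ i, k i)) :=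
  MultilinearLift.lift (fun i => P.generators V (k i)) (fun i => P.generators_surjective V (k i))
    (P.opFormal k μ) (P.opFormal_update k μ)

/-- The operation `(t₁, …, tₙ) ↦ μ(t₁, …, tₙ)` of the free `P`-algebra `S(P, V)`. -/
def schurOp (V : Type*) [AddCommGroup V] [Module F₂ V] {n : ℕ} (μ : P.obj n) :
    MultilinearMap F₂ (fun _ : Fin n => P.Schur V) (P.Schur V) :=
  MultilinearMap.fromDirectSumEquiv (R := F₂) fun k : Fin n → ℕ =>
    (DirectSum.lof F₂ ℕ (P.SchurArity V) (∑ i, k i)).compMultilinearMap (P.opArity k μ)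

/-- The operations are given on monomials by
`μ((ν₁; v₁), …, (νₙ; vₙ)) = (μ(ν₁, …, νₙ); v₁, …, vₙ)`. -/
theorem schurOp_mono {n : ℕ} (μ : P.obj n) (k : Fin n → ℕ) (ν : ∀ i, P.obj (k i))
    (v : ∀ i, Fin (k i) → V) :
    P.schurOp V μ (fun i => P.mono (ν i) (v i)) = P.mono (P.comp k μ ν) (concat v) := by
  have h : P.opArity k μ (fun i => P.monoArity (ν i) (v i)) =
      P.monoArity (P.comp k μ ν) (concat v) := by
    have := MultilinearLift.lift_apply (fun i => P.generators V (k i))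
      (fun i => P.generators_surjective V (k i)) (P.opFormal k μ) (P.opFormal_update k μ)
      (fun i => Finsupp.single (ν i, v i) 1)
    rw [opFormal_single] at this
    simp only [generators, Finsupp.linearCombination_single, one_smul] at this
    exact this
  simp only [schurOp, mono]
  rw [MultilinearMap.fromDirectSumEquiv_lof]
  simp [h]

/-- The grading of `S(P, V)` for a graded vector space `V`, the operad being in degree `0`. -/
def schurDeg (deg : ℕ → Submodule F₂ V) (d : ℕ) : Submodule F₂ (P.Schur V) :=
  Submodule.span F₂ {t | ∃ (n : ℕ) (μ : P.obj n) (v : Fin n → V) (e : Fin n → ℕ),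
    (∀ i, v i ∈ deg (e i)) ∧ ∑ i, e i = d ∧ t = P.mono μ v}

/-- `Sqⁱ` on `V^{⊗n}`, by the Cartan formula. -/
def tensorSq (sq : ℕ → Module.End F₂ V) (n i : ℕ) : Module.End F₂ (⨂[F₂] _ : Fin n, V) :=
  ∑ p ∈ Finset.piAntidiag (Finset.univ : Finset (Fin n)) i, PiTensorProduct.map fun j => sq (p j)

theorem tensorSq_tprod (sq : ℕ → Module.End F₂ V) (n i : ℕ) (v : Fin n → V) :
    tensorSq sq n i (PiTensorProduct.tprod F₂ v) =
      ∑ p ∈ Finset.piAntidiag (Finset.univ : Finset (Fin n)) i,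
        PiTensorProduct.tprod F₂ fun j => sq (p j) (v j) := by
  simp [tensorSq, LinearMap.sum_apply]

theorem coinvariantRelations_le_comap (sq : ℕ → Module.End F₂ V) (i n : ℕ) :
    P.coinvariantRelations V n ≤ (P.coinvariantRelations V n).comap
      (LinearMap.lTensor (P.obj n) (tensorSq sq n i)) := by
  refine Submodule.span_le.2 ?_
  rintro _ ⟨σ, μ, v, rfl⟩
  have hσ : ∑ p ∈ Finset.piAntidiag (Finset.univ : Finset (Fin n)) i,
        μ ⊗ₜ[F₂] PiTensorProduct.tprod F₂ (fun j => sq (p j) ((v ∘ σ) j)) =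
      ∑ p ∈ Finset.piAntidiag (Finset.univ : Finset (Fin n)) i,
        μ ⊗ₜ[F₂] PiTensorProduct.tprod F₂ ((fun j => sq (p j) (v j)) ∘ σ) := by
    refine Finset.sum_nbij' (fun p => p ∘ σ.symm) (fun p => p ∘ σ) ?_ ?_ ?_ ?_ ?_
    · intro p hp
      simp only [Finset.mem_piAntidiag, Finset.mem_univ, implies_true, and_true] at hp ⊢
      rw [← hp]; exact Equiv.sum_comp σ.symm p
    · intro p hp
      simp only [Finset.mem_piAntidiag, Finset.mem_univ, implies_true, and_true] at hp ⊢
      rw [← hp]; exact Equiv.sum_comp σ p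
    · intro p _; funext j; simp
    · intro p _; funext j; simp
    · intro p _
      congr 2
      funext j; simp
  simp only [Submodule.comap_coe, Set.mem_preimage, map_sub, LinearMap.lTensor_tmul,
    tensorSq_tprod, TensorProduct.tmul_sum, SetLike.mem_coe]
  rw [hσ, ← Finset.sum_sub_distrib]
  exact Submodule.sum_mem _ fun p _ => Submodule.subset_span ⟨σ, μ, _, rfl⟩

/-- `Sqⁱ` on `P(n) ⊗_{Σₙ} V^{⊗n}`. -/
def aritySq (sq : ℕ → Module.End F₂ V) (i n : ℕ) : Module.End F₂ (P.SchurArity V n) :=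
  (P.coinvariantRelations V n).mapQ (P.coinvariantRelations V n)
    (LinearMap.lTensor (P.obj n) (tensorSq sq n i)) (P.coinvariantRelations_le_comap sq i n)

/-- `Sqⁱ` on `S(P, V)`, determined by
`Sqⁱ(μ; v₁, …, vₙ) = ∑_{i₁ + ⋯ + iₙ = i} (μ; Sq^{i₁} v₁, …, Sq^{iₙ} vₙ)`. -/
def schurSq (sq : ℕ → Module.End F₂ V) (i : ℕ) : Module.End F₂ (P.Schur V) :=
  DirectSum.lmap (P.aritySq sq i)

theorem schurSq_mono (sq : ℕ → Module.End F₂ V) (i : ℕ) {n : ℕ} (μ : P.obj n) (v : Fin n → V) :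
    P.schurSq sq i (P.mono μ v) =
      ∑ p ∈ Finset.piAntidiag (Finset.univ : Finset (Fin n)) i,
        P.mono μ fun j => sq (p j) (v j) := by
  have h : P.aritySq sq i n (P.monoArity μ v) =
      ∑ p ∈ Finset.piAntidiag (Finset.univ : Finset (Fin n)) i,
        P.monoArity μ fun j => sq (p j) (v j) := by
    simp only [aritySq, monoArity, Submodule.mkQ_apply, Submodule.mapQ_apply,
      LinearMap.lTensor_tmul, tensorSq_tprod, TensorProduct.tmul_sum]
    simp only [← Submodule.mkQ_apply, map_sum]
  simp only [schurSq, mono, DirectSum.lmap_lof, h, map_sum]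

end Schur

end SymmOperad

/-! ### The Steenrod algebra and unstable modules -/

/-- The generators `Sqⁱ`, `i > 0`, and `Sq⁰ = 1`. -/
def freeSq (i : ℕ) : FreeAlgebra F₂ ℕ+ :=
  if h : 0 < i then FreeAlgebra.ι F₂ ⟨i, h⟩ else 1

/-- The Adem relations. -/
inductive AdemRel : FreeAlgebra F₂ ℕ+ → FreeAlgebra F₂ ℕ+ → Prop
  | adem (i j : ℕ) (hi : 0 < i) (hj : 0 < j) (hij : i < 2 * j) :
    AdemRel (freeSq i * freeSq j)
      (∑ k ∈ Finset.range (i / 2 + 1),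
        ((j - k - 1).choose (i - 2 * k) : F₂) • (freeSq (i + j - k) * freeSq k))

/-- The mod 2 Steenrod algebra. -/
abbrev SteenrodAlgebra : Type := RingQuot AdemRel

namespace SteenrodAlgebra

/-- The Steenrod square `Sqⁱ`. -/
def Sq (i : ℕ) : SteenrodAlgebra := RingQuot.mkAlgHom F₂ AdemRel (freeSq i)

/-- The homogeneous elements of degree `d` of the Steenrod algebra. -/
def deg (d : ℕ) : Submodule F₂ SteenrodAlgebra :=
  Submodule.span F₂ {θ | ∃ I : List ℕ, I.sum = d ∧ θ = (I.map Sq).prod}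

end SteenrodAlgebra

/-- An `F₂`-vector space with a family of subspaces (its homogeneous parts) and a family of
operators. The laws of an unstable module are in `SqSpace.IsUnstable`. -/
structure SqSpace where
  carrier : Type*
  [addCommGroup : AddCommGroup carrier]
  [module : Module F₂ carrier]
  deg : ℕ → Submodule F₂ carrier
  sq : ℕ → Module.End F₂ carrier

attribute [instance] SqSpace.addCommGroup SqSpace.module

/-- `M` is an unstable module over the Steenrod algebra, `Sqⁱ` acting by `M.sq i`. -/
structure SqSpace.IsUnstable (M : SqSpace) : Prop where
  graded : DirectSum.IsInternal M.deg
  action : ∃ ρ : SteenrodAlgebra →ₐ[F₂] Module.End F₂ M.carrier,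
    ∀ i, ρ (SteenrodAlgebra.Sq i) = M.sq i
  sq_mem : ∀ (i d : ℕ) (x : M.carrier), x ∈ M.deg d → M.sq i x ∈ M.deg (d + i)
  sq_eq_zero : ∀ (i d : ℕ) (x : M.carrier), x ∈ M.deg d → d < i → M.sq i x = 0

/-- The left ideal generated by the elements `Sqⁱ θ` with `i > n + |θ|`. -/
def excessIdeal (n : ℕ) : Submodule SteenrodAlgebra SteenrodAlgebra :=
  Submodule.span SteenrodAlgebra {x | ∃ (i d : ℕ) (θ : SteenrodAlgebra),
    θ ∈ SteenrodAlgebra.deg d ∧ n + d < i ∧ x = SteenrodAlgebra.Sq i * θ}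

/-- The free unstable module `F(n)` on one generator `ιₙ` of degree `n`: the free module `Σⁿ𝒜` on a
generator of degree `n`, modulo the submodule generated by the instability relations. -/
def freeUnstableModule (n : ℕ) : SqSpace.{0} where
  carrier := SteenrodAlgebra ⧸ excessIdeal n
  deg d := if n ≤ d then
      (SteenrodAlgebra.deg (d - n)).map ((excessIdeal n).mkQ.restrictScalars F₂)
    else ⊥
  sq i := Algebra.lsmul F₂ F₂ (SteenrodAlgebra ⧸ excessIdeal n) (SteenrodAlgebra.Sq i)

/-- The generator `ιₙ` of `F(n)`. -/
def fundamentalClass (n : ℕ) : (freeUnstableModule n).carrier :=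
  (excessIdeal n).mkQ 1

/-! ### `P`-algebras with Steenrod operations -/

/-- A vector space with homogeneous parts, operators `Sqⁱ` and operations `μ(x₁, …, xₙ)` for all
`μ ∈ P(n)`. The laws are in `SqAlgebra.IsAlgebra` and below. -/
structure SqAlgebra (P : SymmOperad) extends SqSpace where
  op : ∀ {n : ℕ}, P.obj n → MultilinearMap F₂ (fun _ : Fin n => carrier) carrier

namespace SqAlgebra

variable {P : SymmOperad} (A : SqAlgebra P)

/-- The operations make `A` a graded algebra over the operad `P`. -/
structure IsAlgebra : Prop where
  op_add : ∀ {n : ℕ} (μ ν : P.obj n) x, A.op (μ + ν) x = A.op μ x + A.op ν x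
  op_smul : ∀ {n : ℕ} (c : F₂) (μ : P.obj n) x, A.op (c • μ) x = c • A.op μ x
  op_rel : ∀ {m n : ℕ} (e : Fin m ≃ Fin n) (μ : P.obj m) (x : Fin n → A.carrier),
    A.op (P.rel e μ) x = A.op μ (x ∘ e)
  op_one : ∀ x : Fin 1 → A.carrier, A.op P.one x = x 0
  op_comp : ∀ {n : ℕ} (k : Fin n → ℕ) (μ : P.obj n) (ν : ∀ i, P.obj (k i))
    (x : Fin (∑ i, k i) → A.carrier),
    A.op (P.comp k μ ν) x =
      A.op μ fun i => A.op (ν i) fun j => x (finSigmaFinEquiv ⟨i, j⟩)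
  op_mem : ∀ {n : ℕ} (μ : P.obj n) (e : Fin n → ℕ) (x : Fin n → A.carrier),
    (∀ i, x i ∈ A.deg (e i)) → A.op μ x ∈ A.deg (∑ i, e i)

/-- The operators `sq` satisfy the (generalised) Cartan formula with respect to the operations
of `A`. -/
def Cartan (sq : ℕ → Module.End F₂ A.carrier) : Prop :=
  ∀ (i : ℕ) {n : ℕ} (μ : P.obj n) (x : Fin n → A.carrier),
    sq i (A.op μ x) =
      ∑ p ∈ Finset.piAntidiag (Finset.univ : Finset (Fin n)) i, A.op μ fun j => sq (p j) (x j)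

/-- `A` is a `⋆`-unstable `P`-algebra: a `P`-algebra in unstable modules such that
`Sq₀ x = ⋆(x, x)`, where `Sq₀ x = Sq^{|x|} x`. -/
structure IsStarUnstable (star : P.obj 2) : Prop where
  isUnstable : A.toSqSpace.IsUnstable
  isAlgebra : A.IsAlgebra
  cartan : A.Cartan A.sq
  sq_top : ∀ (d : ℕ) (x : A.carrier), x ∈ A.deg d → A.sq d x = A.op star ![x, x]

/-- `I` is a `P`-ideal of `A` that is stable under the Steenrod operations. -/
structure IsIdeal (I : Submodule F₂ A.carrier) : Prop where
  op_mem : ∀ {n : ℕ} (μ : P.obj n) (x : Fin n → A.carrier) (i : Fin n), x i ∈ I → A.op μ x ∈ I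
  sq_mem : ∀ (i : ℕ) (x : A.carrier), x ∈ I → A.sq i x ∈ I

/-- The smallest `P`-ideal of `A` that contains `X` and is stable under the Steenrod operations. -/
def idealSpan (X : Set A.carrier) : Submodule F₂ A.carrier :=
  sInf {I | A.IsIdeal I ∧ X ⊆ I}

theorem isIdeal_idealSpan (X : Set A.carrier) : A.IsIdeal (A.idealSpan X) where
  op_mem μ x i hx := by
    simp only [idealSpan, Submodule.mem_sInf, Set.mem_ofPred_eq] at hx ⊢
    exact fun I hI => hI.1.op_mem μ x i (hx I hI)
  sq_mem i x hx := by
    simp only [idealSpan, Submodule.mem_sInf, Set.mem_ofPred_eq] at hx ⊢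
    exact fun I hI => hI.1.sq_mem i x (hx I hI)

/-- The quotient by an ideal. -/
def quotient (I : Submodule F₂ A.carrier) (hI : A.IsIdeal I) : SqAlgebra P where
  carrier := A.carrier ⧸ I
  deg d := (A.deg d).map I.mkQ
  sq i := I.mapQ I (A.sq i) fun x hx => hI.sq_mem i x hx
  op {n} μ := MultilinearLift.lift (fun _ : Fin n => I.mkQ) (fun _ => I.mkQ_surjective)
    (I.mkQ.compMultilinearMap (A.op μ)) fun x i a ha => by
      rw [Submodule.mkQ_apply, Submodule.Quotient.mk_eq_zero] at ha
      simp only [LinearMap.compMultilinearMap_apply, Submodule.mkQ_apply,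
        Submodule.Quotient.mk_eq_zero]
      exact hI.op_mem μ _ i (by simpa using ha)

end SqAlgebra

namespace SymmOperad

variable (P : SymmOperad)

/-- The free `P`-algebra `S(P, M)` with the Steenrod operations induced from `M`. -/
def schurAlgebra (M : SqSpace) : SqAlgebra P where
  carrier := P.Schur M.carrier
  deg := P.schurDeg M.deg
  sq := P.schurSq M.sq
  op μ := P.schurOp M.carrier μ

/-- The elements `Sq₀ t + ⋆(t, t)` of `S(P, M)`, for `t` homogeneous. -/
def unstableRelations (star : P.obj 2) (M : SqSpace) : Set (P.schurAlgebra M).carrier :=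
  {x | ∃ (d : ℕ) (t : (P.schurAlgebra M).carrier), t ∈ (P.schurAlgebra M).deg d ∧
    x = (P.schurAlgebra M).sq d t + (P.schurAlgebra M).op star ![t, t]}

/-- The free `⋆`-unstable `P`-algebra `K_P^⋆(M)` generated by `M`. -/
def freeStarUnstable (star : P.obj 2) (M : SqSpace) : SqAlgebra P :=
  (P.schurAlgebra M).quotient ((P.schurAlgebra M).idealSpan (P.unstableRelations star M))
    ((P.schurAlgebra M).isIdeal_idealSpan _)

/-- The canonical map `M → K_P^⋆(M)`. -/
def freeStarUnstableUnit (star : P.obj 2) (M : SqSpace) (x : M.carrier) :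
    (P.freeStarUnstable star M).carrier :=
  ((P.schurAlgebra M).idealSpan (P.unstableRelations star M)).mkQ (P.mono P.one fun _ => x)

end SymmOperad

/-- The grading of the one-dimensional vector space concentrated in degree `1`. -/
def lineDeg (d : ℕ) : Submodule F₂ F₂ := if d = 1 then ⊤ else ⊥

end

/-! Let `A` be the free graded `P`-algebra on a class `ι` of degree one. The values `ι`, `⋆(ι, ι)`,
`0`, `0`, … extend by the Cartan formula to operators on `A` (`cartanExt`). The heart of the proof
is that `A` with these operators is already `⋆`-unstable (`IsGeneratedByLine.isStarUnstable`).

An element of degree `d` in `A` is `μ(ι, …, ι)` with `μ ∈ P(d)`, and `Sqʲ ι = 0` for `j ≥ 2`.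
Instability is therefore a pigeonhole argument. In `Sqᵈ` only the term `μ(⋆(ι, ι), …, ⋆(ι, ι))`
survives, and the interchange law turns it into `⋆(x, x)`: the shuffle is invisible because all
inputs are `ι`.

For the Adem relations put `Sq_u = ∑ uⁱ Sqⁱ`. Commutativity of `⋆` gives `Sq_u Sq_v ι = ι + (u + v)
Sq¹ι + u² v ⋆(Sq¹ι, Sq¹ι)` (`sq_sq`). Expanding inside `μ` leaves the coefficients of `(u + v)ˢ (u²
v)ᵗ`, so it is enough that these satisfy the Adem relations (`twoVarCoeff_adem`). A shift of
exponents reduces this to one binomial identity modulo 2 (`choose_add_eq_sum`), read off from two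
expansions of a power series.

To compare, let `φ : A → K` be the algebra map with `ι ↦ ι₁`. Since `A` is `⋆`-unstable, the
universal properties of `F(1)` and `K` give an algebra map `ψ : K → A` with `ι₁ ↦ ι`, and `ψ ∘ φ`
fixes `ι`, so it is the identity. The class `ι₁` has the same squares in `K` as `ι` in `A`: `Sq¹` by
the defining relation, higher ones by instability of `F(1)`. Hence `φ` commutes with the squares,
its image contains the image of `F(1)`, and `φ` is onto. All the structure is transported along `φ`,
and uniqueness holds because every element of `K` is a sum of elements `μ(ι₁, …, ι₁)`. -/

noncomputable section

/-! ### Binomial coefficients modulo 2 -/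

section Binomial

open PowerSeries Finset

/-- Modulo 2, `(1 + X)⁻¹` is the power series with all coefficients equal to one. -/
theorem mk_one_mul_one_add_X : (mk 1 : PowerSeries F₂) * (1 + X) = 1 := by
  have : CharP (PowerSeries F₂) 2 := charP_of_injective_algebraMap
    (algebraMap F₂ (PowerSeries F₂)).injective 2
  rw [← CharTwo.sub_eq_add]
  exact mk_one_mul_one_sub_eq_one F₂

/-- The coefficient is the central binomial coefficient `C(2d, d)`, which is even for `d > 0`. -/
theorem coeff_mk_one_pow_succ (d : ℕ) :
    coeff d ((mk 1 : PowerSeries F₂) ^ (d + 1)) = if d = 0 then 1 else 0 := by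
  rw [mk_one_pow_eq_mk_choose_add, coeff_mk]
  split_ifs with h
  · subst h; simp
  · rw [← two_mul, ← Nat.centralBinom_eq_two_mul_choose, ZMod.natCast_eq_zero_iff]
    exact Nat.two_dvd_centralBinom_of_one_le (Nat.one_le_iff_ne_zero.2 h)

/-- The Adem relation on a product of classes of degree one. -/
theorem choose_add_eq_sum (i j : ℕ) (hij : i < 2 * j) :
    ((i + j).choose i : F₂) =
      ∑ k ∈ range (i / 2 + 1), ((j - k - 1).choose (i - 2 * k) : F₂) * ((i + j).choose k : F₂) := by
  set u : PowerSeries F₂ := mk 1 with hu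
  have hu1 : u * (1 + X) = 1 := mk_one_mul_one_add_X
  have hu' : (1 + X) * u = 1 := by rw [mul_comm, hu1]
  have hpow : ∀ a b : ℕ, (1 + X) ^ (a + b) * u ^ b = (1 + X : PowerSeries F₂) ^ a := by
    intro a b; rw [pow_add, mul_assoc, ← mul_pow, hu', one_pow, mul_one]
  have hpow' : ∀ a b : ℕ, (1 + X) ^ b * u ^ (a + b) = u ^ a := by
    intro a b; rw [pow_add, mul_comm (u ^ a), ← mul_assoc, ← mul_pow, hu', one_pow, one_mul]
  -- With `u = (1 + X)⁻¹`, one has `X² u + 1 = u (X (1 + X) + 1)`. Expanding the power on either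
  -- side by the binomial theorem and taking the coefficient of `Xⁱ` gives the two sides of the
  -- claim.
  have e1 : (1 + X) ^ (j - 1) * (X ^ 2 * u + 1) ^ (i + j) =
      (1 + X) ^ (j - 1) * u ^ (i + j) * (X * (1 + X) + 1) ^ (i + j) := by
    rw [mul_assoc, ← mul_pow]
    congr 2
    linear_combination -hu'
  have e2 := congrArg (coeff i) e1
  rw [add_pow (X ^ 2 * u), add_pow (X * (1 + X)), mul_sum, mul_sum, map_sum, map_sum] at e2
  have hL : ∀ k ∈ range (i + j + 1),
      coeff i ((1 + X) ^ (j - 1) * ((X ^ 2 * u) ^ k * 1 ^ (i + j - k) *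
        ((i + j).choose k : PowerSeries F₂))) =
        if k ∈ range (i / 2 + 1) then
          ((j - k - 1).choose (i - 2 * k) : F₂) * ((i + j).choose k : F₂) else 0 := by
    intro k hk
    have : (1 + X) ^ (j - 1) * ((X ^ 2 * u) ^ k * 1 ^ (i + j - k) *
          ((i + j).choose k : PowerSeries F₂))
        = C ((i + j).choose k : F₂) * (((1 + X) ^ (j - 1) * u ^ k) * X ^ (2 * k)) := by
      rw [map_natCast]; ring
    rw [this, coeff_C_mul, coeff_mul_X_pow']
    have hiff : k ∈ range (i / 2 + 1) ↔ 2 * k ≤ i := by rw [mem_range]; omega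
    simp only [hiff]
    split_ifs with h
    -- `2k ≤ i < 2j` forces `k < j`, so `uᵏ` cancels against `(1 + X)^(j - 1)` without leaving a
    -- negative power.
    · have : j - 1 = (j - k - 1) + k := by omega
      rw [this, hpow, mul_comm]
      congr 1
      rw [show (1 + X : PowerSeries F₂) ^ (j - k - 1) =
        (((1 + Polynomial.X) ^ (j - k - 1) : Polynomial F₂) : PowerSeries F₂) by simp,
        Polynomial.coeff_coe, Polynomial.coeff_one_add_X_pow]
    · simp
  have hR : ∀ m ∈ range (i + j + 1),
      coeff i ((1 + X) ^ (j - 1) * u ^ (i + j) *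
        ((X * (1 + X)) ^ m * 1 ^ (i + j - m) * ((i + j).choose m : PowerSeries F₂))) =
        if i = m then ((i + j).choose i : F₂) else 0 := by
    intro m hm
    have : (1 + X) ^ (j - 1) * u ^ (i + j) *
        ((X * (1 + X)) ^ m * 1 ^ (i + j - m) * ((i + j).choose m : PowerSeries F₂))
        = C ((i + j).choose m : F₂) * (((1 + X) ^ (j - 1 + m) * u ^ (i + j)) * X ^ m) := by
      rw [map_natCast, mul_pow]; ring
    rw [this, coeff_C_mul, coeff_mul_X_pow']
    split_ifs with h h' h'
    · subst h'
      have : i + j = 1 + (j - 1 + i) := by omega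
      rw [show u ^ (i + j) = u ^ (1 + (j - 1 + i)) by rw [← this], hpow']
      simp [hu]
    -- What is left is the coefficient of `X^(i - m)` in `u^(i - m + 1)`, a central binomial
    -- coefficient; it vanishes because `m < i`.
    · have : i + j = (i - m + 1) + (j - 1 + m) := by omega
      rw [show u ^ (i + j) = u ^ ((i - m + 1) + (j - 1 + m)) by rw [← this], hpow',
        coeff_mk_one_pow_succ, if_neg (by omega), mul_zero]
    · omega
    · simp
  rw [sum_congr rfl hL, sum_congr rfl hR, ← sum_filter, ← sum_filter, filter_mem_eq_inter,
    inter_eq_right.2 (by intro k; simp only [mem_range]; omega), filter_eq,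
    if_pos (by simp only [mem_range]; omega), sum_singleton] at e2
  exact e2.symm

/-! ### Adem relations as identities between two-variable generating series. -/

/-- The coefficient of `uⁱ vʲ` in `(u + v)ˢ (u² v)ᵗ` modulo 2. -/
def twoVarCoeff (s t i j : ℕ) : F₂ :=
  if 2 * t ≤ i ∧ i + j = s + 3 * t then (s.choose (i - 2 * t) : F₂) else 0

theorem twoVarCoeff_adem (s t i j : ℕ) (hij : i < 2 * j) :
    twoVarCoeff s t i j =
      ∑ k ∈ range (i / 2 + 1),
        ((j - k - 1).choose (i - 2 * k) : F₂) * twoVarCoeff s t (i + j - k) k := by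
  by_cases hs : i + j = s + 3 * t
  swap
  · rw [sum_eq_zero]
    · simp [twoVarCoeff, hs]
    · intro k hk
      rw [mem_range] at hk
      rw [twoVarCoeff, if_neg (by omega), mul_zero]
  by_cases ht : 2 * t ≤ i
  swap
  · rw [sum_eq_zero]
    · simp [twoVarCoeff, ht]
    · intro k hk
      rw [mem_range] at hk
      rw [twoVarCoeff]
      split_ifs
      · rw [Nat.choose_eq_zero_of_lt (by omega : s < i + j - k - 2 * t)]; simp
      · simp
  -- Dividing by `(u² v)ᵗ` replaces `(i, j, k)` by `(i - 2t, j - t, k - t)`, which leaves both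
  -- binomial coefficients of the relation and the bound `i < 2j` intact. The terms with `k < t`
  -- vanish, since the `u`-exponent then exceeds `s`.
  obtain ⟨i', rfl⟩ := Nat.exists_eq_add_of_le ht
  obtain ⟨j', rfl⟩ := Nat.exists_eq_add_of_le (by omega : t ≤ j)
  obtain rfl : s = i' + j' := by omega
  have key := choose_add_eq_sum i' j' (by omega)
  rw [twoVarCoeff, if_pos (by omega), show 2 * t + i' - 2 * t = i' by omega, key,
    show (2 * t + i') / 2 + 1 = t + (i' / 2 + 1) by omega, sum_range_add _ t,
    sum_eq_zero (s := range t), zero_add]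
  · refine sum_congr rfl fun k hk => ?_
    rw [mem_range] at hk
    rw [show t + j' - (t + k) - 1 = j' - k - 1 by omega,
      show 2 * t + i' - 2 * (t + k) = i' - 2 * k by omega, twoVarCoeff]
    congr 1
    rw [if_pos (by omega), show 2 * t + i' + (t + j') - (t + k) - 2 * t = i' + j' - k by omega,
      Nat.choose_symm (by omega)]
  · intro k hk
    rw [mem_range] at hk
    rw [twoVarCoeff]
    split_ifs
    · rw [Nat.choose_eq_zero_of_lt
        (by omega : i' + j' < 2 * t + i' + (t + j') - k - 2 * t)]
      simp
    · simp

/-- The series `1`, `u + v` and `u² v`, as power series in `u` over power series in `v`. -/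
def ademSeries : Fin 3 → PowerSeries (PowerSeries F₂) :=
  ![1, X + C X, X ^ 2 * C X]

theorem coeff_coeff_ademSeries (s t i j : ℕ) :
    coeff j (coeff i (ademSeries 1 ^ s * ademSeries 2 ^ t)) = twoVarCoeff s t i j := by
  have h : ademSeries 1 ^ s * ademSeries 2 ^ t =
      ∑ m ∈ range (s + 1),
        C (X ^ (s - m + t) * (s.choose m : PowerSeries F₂)) * X ^ (m + 2 * t) := by
    simp only [ademSeries, Matrix.cons_val]
    rw [add_pow, sum_mul]
    refine sum_congr rfl fun m hm => ?_
    simp only [map_mul, map_pow, map_natCast]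
    ring
  rw [h, map_sum, map_sum, twoVarCoeff]
  have : ∀ m ∈ range (s + 1),
      coeff j (coeff i (C (X ^ (s - m + t) * (s.choose m : PowerSeries F₂)) * X ^ (m + 2 * t))) =
      if i = m + 2 * t then (if j = s - m + t then (s.choose m : F₂) else 0) else 0 := by
    intro m _
    rw [coeff_C_mul, coeff_X_pow]
    split_ifs with h1 h2
    · rw [mul_one, ← map_natCast (C : F₂ →+* PowerSeries F₂), coeff_mul_C, coeff_X_pow, if_pos h2,
        one_mul]
    · rw [mul_one, ← map_natCast (C : F₂ →+* PowerSeries F₂), coeff_mul_C, coeff_X_pow, if_neg h2,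
        zero_mul]
    · simp
  rw [sum_congr rfl this]
  split_ifs with hc
  · rcases le_or_gt (i - 2 * t) s with hm | hm
    · rw [sum_eq_single_of_mem (i - 2 * t) (by rw [mem_range]; omega)
        fun m _ hm' => if_neg (by omega), if_pos (by omega), if_pos (by omega)]
    · rw [Nat.choose_eq_zero_of_lt hm, Nat.cast_zero]
      refine sum_eq_zero fun m hm' => if_neg ?_
      rw [mem_range] at hm'
      omega
  · refine sum_eq_zero fun m hm' => ?_
    rw [mem_range] at hm'
    split_ifs
    · omega
    · rfl
    · rfl

theorem sum_piAntidiag_prod_coeff {R ι : Type*} [CommRing R] [Fintype ι] [DecidableEq ι]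
    (f : ι → PowerSeries R) (d : ℕ) :
    ∑ p ∈ piAntidiag univ d, ∏ l, coeff (p l) (f l) = coeff d (∏ l, f l) := by
  rw [coeff_prod]
  refine sum_nbij' (fun p => Finsupp.equivFunOnFinite.symm p) (fun p => p) ?_ ?_ ?_ ?_ ?_
  · intro p hp; simpa using hp
  · intro p hp; simpa using hp
  · intro p _; rfl
  · intro p _; ext; rfl
  · intro p _; rfl

/-- The Adem relation for a two-parameter family of sums, whose terms are obtained by
inserting the coefficients of `x₀ + (u + v) x₁ + u² v x₂` in a multilinear map. -/
theorem sum_piAntidiag_adem {n : ℕ} {W Z : Type*} [AddCommGroup W] [Module F₂ W] [AddCommGroup Z]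
    [Module F₂ Z] (m : MultilinearMap F₂ (fun _ : Fin n => W) Z) (x : Fin 3 → W)
    (y : ℕ → ℕ → W) (hy : ∀ a b, y a b = ∑ c, coeff b (coeff a (ademSeries c)) • x c)
    (i j : ℕ) (hij : i < 2 * j) :
    ∑ p ∈ piAntidiag univ j, ∑ q ∈ piAntidiag univ i, m (fun l => y (q l) (p l)) =
      ∑ k ∈ range (i / 2 + 1), ((j - k - 1).choose (i - 2 * k) : F₂) •
        ∑ p ∈ piAntidiag univ k, ∑ q ∈ piAntidiag univ (i + j - k), m fun l => y (q l) (p l) := by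
  -- Expanding each slot gives a sum over words `w` in the letters `0, 1, 2`. The coefficient of a
  -- word is that of `uⁱ vʲ` in the product of the series of its letters, hence depends only on the
  -- numbers of letters `1` and `2`.
  have key : ∀ i j : ℕ,
      ∑ p ∈ piAntidiag univ j, ∑ q ∈ piAntidiag univ i, m (fun l => y (q l) (p l)) =
      ∑ w : Fin n → Fin 3, twoVarCoeff #{l | w l = 1} #{l | w l = 2} i j • m fun l => x (w l) := by
    intro i j
    simp only [hy, m.map_sum, m.map_smul_univ]
    rw [sum_comm]
    simp only [sum_comm (t := (univ : Finset (Fin n → Fin 3))), ← sum_smul]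
    refine sum_congr rfl fun w _ => ?_
    congr 1
    rw [sum_congr rfl fun q _ => sum_piAntidiag_prod_coeff _ _, ← map_sum,
      sum_piAntidiag_prod_coeff (fun l => ademSeries (w l)), ← coeff_coeff_ademSeries,
      ← Fintype.prod_fiberwise' w ademSeries, Fin.prod_univ_three]
    simp only [prod_const]
    simp [ademSeries, Fintype.card_subtype]
  simp only [key, smul_sum]
  rw [sum_comm (s := range _)]
  refine sum_congr rfl fun w _ => ?_
  rw [twoVarCoeff_adem _ _ _ _ hij, sum_smul]
  exact sum_congr rfl fun k _ => mul_smul _ _ _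

/-- Distributing `i` over all inputs amounts to distributing it over the blocks and then inside each
block. This makes the Cartan formula compatible with operadic composition. -/
theorem sum_piAntidiag_sigma {Z : Type*} [AddCommMonoid Z] {n : ℕ} (k : Fin n → ℕ)
    (G : (∀ a, Fin (k a) → ℕ) → Z) (i : ℕ) :
    ∑ p ∈ piAntidiag (univ : Finset (Fin (∑ a, k a))) i,
        G (fun a b => p (finSigmaFinEquiv ⟨a, b⟩)) =
      ∑ q ∈ piAntidiag univ i, ∑ r ∈ Fintype.piFinset fun a => piAntidiag univ (q a), G r := by
  have hsum : ∀ p : Fin (∑ a, k a) → ℕ,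
      ∑ a, ∑ b, p (finSigmaFinEquiv ⟨a, b⟩) = ∑ c, p c := by
    intro p
    rw [← Equiv.sum_comp finSigmaFinEquiv, Fintype.sum_sigma]
  rw [sum_sigma']
  refine sum_nbij' (fun p => ⟨fun a => ∑ b, p (finSigmaFinEquiv ⟨a, b⟩),
    fun a b => p (finSigmaFinEquiv ⟨a, b⟩)⟩)
    (fun x => SymmOperad.concat x.2) ?_ ?_ ?_ ?_ ?_
  · intro p hp
    simpa [hsum] using hp
  · rintro ⟨q, r⟩ h
    simp only [mem_sigma, mem_piAntidiag, mem_univ, implies_true, and_true,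
      Fintype.mem_piFinset] at h ⊢
    rw [← hsum]
    simp only [SymmOperad.concat_apply, h.2, h.1]
  · intro p _
    funext c
    obtain ⟨⟨a, b⟩, rfl⟩ := finSigmaFinEquiv.surjective c
    rw [SymmOperad.concat_apply]
  · rintro ⟨q, r⟩ h
    simp only [mem_sigma, mem_piAntidiag, mem_univ, implies_true, and_true,
      Fintype.mem_piFinset] at h
    obtain rfl : q = fun a => ∑ b, r a b := funext fun a => (h.2 a).symm
    simp only [SymmOperad.concat_apply]
  · intro p _
    rfl

end Binomial

/-! ### The free algebra over an operad -/

/-- Induction over the entries of a family of vectors, each in the span of a given set. -/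
theorem span_pi_induction {ι : Type*} [Fintype ι] [DecidableEq ι] {W : Type*} [AddCommGroup W]
    [Module F₂ W] {S : ι → Set W} {C : (ι → W) → Prop}
    (mem : ∀ x, (∀ i, x i ∈ S i) → C x)
    (zero : ∀ x i, C (Function.update x i 0))
    (add : ∀ x i a b, C (Function.update x i a) → C (Function.update x i b) →
      C (Function.update x i (a + b)))
    (x : ι → W) (hx : ∀ i, x i ∈ Submodule.span F₂ (S i)) : C x := by
  suffices h : ∀ s : Finset ι, ∀ x : ι → W, (∀ i ∈ s, x i ∈ Submodule.span F₂ (S i)) →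
      (∀ i ∉ s, x i ∈ S i) → C x from h Finset.univ x (by simpa using hx) (by simp)
  intro s
  induction s using Finset.induction_on with
  | empty => exact fun x _ h => mem x (by simpa using h)
  | insert b s hb ih =>
    intro x h1 h2
    have key : ∀ c ∈ Submodule.span F₂ (S b), C (Function.update x b c) := by
      intro c hc
      induction hc using Submodule.span_induction with
      | mem c hc =>
        refine ih _ (fun i hi => ?_) fun i hi => ?_
        · rw [Function.update_of_ne (ne_of_mem_of_not_mem hi hb)]
          exact h1 i (by simp [hi])
        · by_cases hib : i = b
          · subst hib; simpa using hc
          · rw [Function.update_of_ne hib]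
            exact h2 i (by simp [hib, hi])
      | zero => exact zero x b
      | add c d _ _ hc hd => exact add x b c d hc hd
      | smul r c _ hc =>
        rcases (by decide : ∀ r : F₂, r = 0 ∨ r = 1) r with rfl | rfl
        · rw [zero_smul]; exact zero x b
        · rwa [one_smul]
    simpa using key (x b) (h1 b (by simp))

namespace SymmOperad

variable (P : SymmOperad) {V : Type*} [AddCommGroup V] [Module F₂ V]

theorem mono_rel {m n : ℕ} (e : Fin m ≃ Fin n) (μ : P.obj m) (v : Fin n → V) :
    P.mono (P.rel e μ) v = P.mono μ (v ∘ e) := by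
  -- A bijection forces equal arities, so the coinvariant relation applies.
  obtain rfl : m = n := by simpa using Fintype.card_congr e
  simp only [mono, monoArity_rel]

/-- `mono`, as a map that is linear in the operation and multilinear in the entries. -/
def monoₗ (V : Type*) [AddCommGroup V] [Module F₂ V] (n : ℕ) :
    P.obj n →ₗ[F₂] MultilinearMap F₂ (fun _ : Fin n => V) (P.Schur V) :=
  (LinearMap.compMultilinearMapₗ F₂ (DirectSum.lof F₂ ℕ (P.SchurArity V) n)) ∘ₗ P.monoArityₗ V n

theorem monoₗ_apply {n : ℕ} (μ : P.obj n) (v : Fin n → V) : P.monoₗ V n μ v = P.mono μ v := rfl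

theorem span_mono : Submodule.span F₂ {t : P.Schur V | ∃ (n : ℕ) (μ : P.obj n) (v : Fin n → V),
    t = P.mono μ v} = ⊤ := by
  rw [eq_top_iff]
  rintro x -
  induction x using DirectSum.induction_on with
  | zero => exact Submodule.zero_mem _
  | add x y hx hy => exact Submodule.add_mem _ hx hy
  | of n x =>
    obtain ⟨c, rfl⟩ := P.generators_surjective V n x
    change DirectSum.lof F₂ ℕ (P.SchurArity V) n _ ∈ _
    induction c using Finsupp.induction_linear with
    | zero => simp
    | add a b ha hb => rw [map_add, map_add]; exact Submodule.add_mem _ ha hb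
    | single z r =>
      rw [generators, Finsupp.linearCombination_single, map_smul]
      exact Submodule.smul_mem _ _ (Submodule.subset_span ⟨n, z.1, z.2, rfl⟩)

variable {P}

@[elab_as_elim]
theorem schur_induction {C : P.Schur V → Prop} (x : P.Schur V) (zero : C 0)
    (add : ∀ x y, C x → C y → C (x + y))
    (mono : ∀ (n : ℕ) (μ : P.obj n) (v : Fin n → V), C (P.mono μ v)) : C x := by
  have hx : x ∈ Submodule.span F₂ {t : P.Schur V | ∃ (n : ℕ) (μ : P.obj n) (v : Fin n → V),
    t = P.mono μ v} := by rw [span_mono]; trivial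
  induction hx using Submodule.span_induction with
  | mem x hx => obtain ⟨n, μ, v, rfl⟩ := hx; exact mono n μ v
  | zero => exact zero
  | add x y _ _ hx hy => exact add x y hx hy
  | smul r x _ hx =>
    rcases (by decide : ∀ r : F₂, r = 0 ∨ r = 1) r with rfl | rfl
    · rwa [zero_smul]
    · rwa [one_smul]

theorem schur_pi_induction {n : ℕ} {C : (Fin n → P.Schur V) → Prop} (x : Fin n → P.Schur V)
    (zero : ∀ x i, C (Function.update x i 0))
    (add : ∀ x i a b, C (Function.update x i a) → C (Function.update x i b) →
      C (Function.update x i (a + b)))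
    (mono : ∀ (k : Fin n → ℕ) (μ : ∀ i, P.obj (k i)) (v : ∀ i, Fin (k i) → V),
      C fun i => P.mono (μ i) (v i)) : C x := by
  refine span_pi_induction (S := fun _ => {t : P.Schur V |
    ∃ (n : ℕ) (μ : P.obj n) (v : Fin n → V), t = P.mono μ v}) ?_ zero add x
    fun i => by rw [span_mono]; trivial
  intro x hx
  choose k μ v h using hx
  obtain rfl : x = fun i => P.mono (μ i) (v i) := funext h
  exact mono k μ v

theorem schur_hom_ext {Z : Type*} [AddCommGroup Z] [Module F₂ Z] {f g : P.Schur V →ₗ[F₂] Z}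
    (h : ∀ (n : ℕ) (μ : P.obj n) (v : Fin n → V), f (P.mono μ v) = g (P.mono μ v)) : f = g := by
  ext1 n
  ext x
  have := fun x => schur_induction (C := fun x => f x = g x) x (by simp)
    (fun x y hx hy => by rw [map_add, map_add, hx, hy]) h
  exact this _

/-! ### The algebra laws on `S(P, V)`: multilinearity reduces them to monomials, where they are
operad axioms. -/

theorem schurOp_add {n : ℕ} (μ ν : P.obj n) (x : Fin n → P.Schur V) :
    P.schurOp V (μ + ν) x = P.schurOp V μ x + P.schurOp V ν x := by
  induction x using schur_pi_induction with
  | zero x i => simp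
  | add x i a b ha hb => simp only [MultilinearMap.map_update_add, ha, hb]; abel
  | mono k ξ v =>
    rw [schurOp_mono, schurOp_mono, schurOp_mono, map_add]
    exact congrArg (fun f => f (concat v)) (map_add (P.monoₗ V _) _ _)

theorem schurOp_smul {n : ℕ} (c : F₂) (μ : P.obj n) (x : Fin n → P.Schur V) :
    P.schurOp V (c • μ) x = c • P.schurOp V μ x := by
  induction x using schur_pi_induction with
  | zero x i => simp
  | add x i a b ha hb => simp only [MultilinearMap.map_update_add, ha, hb, smul_add]
  | mono k ξ v =>
    rw [schurOp_mono, schurOp_mono, map_smul]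
    exact congrArg (fun f => f (concat v)) (map_smul (P.monoₗ V _) c _)

theorem schurOp_rel {m n : ℕ} (e : Fin m ≃ Fin n) (μ : P.obj m) (x : Fin n → P.Schur V) :
    P.schurOp V (P.rel e μ) x = P.schurOp V μ (x ∘ e) := by
  induction x using schur_pi_induction with
  | zero x i => simp [Function.update_comp_equiv]
  | add x i a b ha hb =>
    simp only [Function.update_comp_equiv, MultilinearMap.map_update_add] at ha hb ⊢
    rw [ha, hb]
  | mono k ξ v =>
    have : (fun i => P.mono (ξ i) (v i)) ∘ e = fun i => P.mono (ξ (e i)) (v (e i)) := rfl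
    rw [this, schurOp_mono, schurOp_mono, P.rel_comp, mono_rel]
    congr 1
    funext c
    obtain ⟨⟨i, j⟩, rfl⟩ := finSigmaFinEquiv.surjective c
    simp only [Function.comp_apply, Equiv.trans_apply, Equiv.symm_apply_apply,
      concat_apply (fun i => v (e i))]
    exact concat_apply v (e i) j

theorem schurOp_one (x : Fin 1 → P.Schur V) : P.schurOp V P.one x = x 0 := by
  obtain ⟨t, rfl⟩ : ∃ t, x = fun _ => t := ⟨x 0, funext fun i => by rw [Subsingleton.elim i 0]⟩
  have hu : ∀ a : P.Schur V, (fun _ : Fin 1 => a) = Function.update (fun _ => 0) 0 a := by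
    intro a; funext i; rw [Subsingleton.elim i 0]; simp
  induction t using schur_induction with
  | zero => rw [hu, MultilinearMap.map_update_zero]; simp
  | add a b ha hb =>
    rw [hu] at ha hb ⊢
    rw [MultilinearMap.map_update_add, ha, hb]; simp
  | mono n μ v =>
    rw [schurOp_mono P P.one (fun _ => n) (fun _ => μ) (fun _ => v), P.one_comp, mono_rel]
    congr 1
    funext c
    exact concat_apply (k := fun _ : Fin 1 => n) (fun _ => v) 0 c

theorem concat_nestedBlocks {W : Type*} {n : ℕ} (k : Fin n → ℕ) (l : ∀ i, Fin (k i) → ℕ)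
    (v : ∀ i j, Fin (l i j) → W) :
    concat (fun p : Fin (∑ i, k i) => v (finSigmaFinEquiv.symm p).1 (finSigmaFinEquiv.symm p).2) ∘
      nestedBlocks k l = concat fun i => concat (v i) := by
  funext c
  obtain ⟨⟨i, c⟩, rfl⟩ := finSigmaFinEquiv.surjective c
  obtain ⟨⟨j, b⟩, rfl⟩ := finSigmaFinEquiv.surjective c
  rw [concat_apply, concat_apply]
  simp only [nestedBlocks, Function.comp_apply, Equiv.trans_apply, Equiv.symm_apply_apply,
    Equiv.sigmaCongrRight_apply]
  -- Transport along `finSigmaFinEquiv` changes the type of the innermost index. Comparing whole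
  -- points of the sigma type avoids an explicit cast.
  set y := (Equiv.sigmaCongrLeft' (β := fun q : (i : Fin n) × Fin (k i) => Fin (l q.1 q.2))
    finSigmaFinEquiv) ((Equiv.sigmaAssoc fun i j => Fin (l i j)).symm ⟨i, j, b⟩) with hy
  have hz : ⟨⟨i, j⟩, b⟩ = (Equiv.sigmaCongrLeft' (β := fun q : (i : Fin n) × Fin (k i) =>
      Fin (l q.1 q.2)) finSigmaFinEquiv).symm y := by
    rw [hy, Equiv.symm_apply_apply]; rfl
  exact (concat_apply (k := fun p => l (finSigmaFinEquiv.symm p).1 (finSigmaFinEquiv.symm p).2)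
    (fun p => v (finSigmaFinEquiv.symm p).1 (finSigmaFinEquiv.symm p).2) y.1 y.2).trans
    (congrArg (fun z : (q : (i : Fin n) × Fin (k i)) ×
    Fin (l q.1 q.2) => v z.1.1 z.1.2 z.2) hz).symm

end SymmOperad

/-- An input of a nested composite lies in exactly one block. This is what makes the right-hand side
of the composition law additive in each input. -/
theorem op_update_sigma {W : Type*} [AddCommGroup W] [Module F₂ W] {n : ℕ} (k : Fin n → ℕ)
    (f : ∀ i, MultilinearMap F₂ (fun _ : Fin (k i) => W) W) (x : Fin (∑ i, k i) → W) (i : Fin n)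
    (j : Fin (k i)) (a : W) :
    (fun i' => f i' fun j' => Function.update x (finSigmaFinEquiv ⟨i, j⟩) a
      (finSigmaFinEquiv ⟨i', j'⟩)) =
    Function.update (fun i' => f i' fun j' => x (finSigmaFinEquiv ⟨i', j'⟩)) i
      (f i (Function.update (fun j' => x (finSigmaFinEquiv ⟨i, j'⟩)) j a)) := by
  funext i'
  by_cases hi : i' = i
  · subst hi
    rw [Function.update_self]
    congr 1
    funext j'
    by_cases hj : j' = j
    · subst hj; simp
    · rw [Function.update_of_ne hj, Function.update_of_ne]
      simpa using hj
  · rw [Function.update_of_ne hi]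
    congr 1
    funext j'
    rw [Function.update_of_ne]
    intro h
    exact hi (congrArg Sigma.fst (finSigmaFinEquiv.injective h))

namespace SymmOperad

variable {P : SymmOperad} {V : Type*} [AddCommGroup V] [Module F₂ V]

theorem schurOp_comp {n : ℕ} (k : Fin n → ℕ) (μ : P.obj n) (ν : ∀ i, P.obj (k i))
    (x : Fin (∑ i, k i) → P.Schur V) :
    P.schurOp V (P.comp k μ ν) x =
      P.schurOp V μ fun i => P.schurOp V (ν i) fun j => x (finSigmaFinEquiv ⟨i, j⟩) := by
  refine span_pi_induction (S := fun _ => {t : P.Schur V |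
    ∃ (n : ℕ) (μ : P.obj n) (v : Fin n → V), t = P.mono μ v})
    (C := fun x => P.schurOp V (P.comp k μ ν) x =
      P.schurOp V μ fun i => P.schurOp V (ν i) fun j => x (finSigmaFinEquiv ⟨i, j⟩)) ?_ ?_ ?_ x
    fun i => by rw [span_mono]; trivial
  · intro x hx
    choose l ξ v h using fun i j => hx (finSigmaFinEquiv ⟨i, j⟩)
    simp only [h, schurOp_mono]
    have : x = fun p => P.mono (ξ (finSigmaFinEquiv.symm p).1 (finSigmaFinEquiv.symm p).2)
        (v (finSigmaFinEquiv.symm p).1 (finSigmaFinEquiv.symm p).2) := by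
      funext p
      rw [← h]
      exact congrArg x (finSigmaFinEquiv.apply_symm_apply p).symm
    rw [this, schurOp_mono, P.comp_assoc, mono_rel, concat_nestedBlocks]
  · intro x c
    obtain ⟨⟨i, j⟩, rfl⟩ := finSigmaFinEquiv.surjective c
    have hu := op_update_sigma k (fun i => P.schurOp V (ν i)) x i j
    beta_reduce at hu
    rw [hu]
    simp
  · intro x c a b ha hb
    obtain ⟨⟨i, j⟩, rfl⟩ := finSigmaFinEquiv.surjective c
    have hu := op_update_sigma k (fun i => P.schurOp V (ν i)) x i j
    beta_reduce at hu
    rw [hu] at ha hb ⊢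
    simp only [MultilinearMap.map_update_add, ha, hb]

theorem schurOp_mem (deg : ℕ → Submodule F₂ V) {n : ℕ} (μ : P.obj n) (e : Fin n → ℕ)
    (x : Fin n → P.Schur V) (hx : ∀ i, x i ∈ P.schurDeg deg (e i)) :
    P.schurOp V μ x ∈ P.schurDeg deg (∑ i, e i) := by
  refine span_pi_induction (C := fun x => P.schurOp V μ x ∈ P.schurDeg deg (∑ i, e i))
    ?_ ?_ ?_ x hx
  · intro x hx
    choose k ν v d hd hsum hx using hx
    obtain rfl := funext hx
    rw [schurOp_mono]
    refine Submodule.subset_span ⟨_, _, _, concat d, ?_, ?_, rfl⟩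
    · intro c
      exact hd _ _
    · rw [← Equiv.sum_comp finSigmaFinEquiv, Fintype.sum_sigma]
      simp only [concat_apply, hsum]
  · intro x i; simp
  · intro x i a b ha hb
    rw [MultilinearMap.map_update_add]
    exact Submodule.add_mem _ ha hb

theorem schurAlgebra_isAlgebra (M : SqSpace) : (P.schurAlgebra M).IsAlgebra where
  op_add := schurOp_add
  op_smul := schurOp_smul
  op_rel := schurOp_rel
  op_one := schurOp_one
  op_comp := schurOp_comp
  op_mem := schurOp_mem M.deg

/-- A monomial is obtained by applying its operation to its entries. -/
theorem mono_eq_schurOp {n : ℕ} (μ : P.obj n) (v : Fin n → V) :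
    P.mono μ v = P.schurOp V μ fun i => P.mono P.one fun _ => v i := by
  rw [schurOp_mono P μ (fun _ => 1) (fun _ => P.one) (fun i _ => v i), P.comp_one, mono_rel]
  congr 1
  funext i
  exact (concat_apply (k := fun _ : Fin n => 1) (fun i _ => v i) i 0).symm

end SymmOperad

/-! ### Extensions along the Cartan formula -/

namespace SqAlgebra

open Finset

variable {P : SymmOperad} {B : SqAlgebra P} {V : Type*} [AddCommGroup V] [Module F₂ V]

/-- A family of linear maps from `S(P, V)` to an algebra that satisfies the Cartan formula. -/
def CartanFamily (B : SqAlgebra P) (g : ℕ → P.Schur V →ₗ[F₂] B.carrier) : Prop :=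
  ∀ (i : ℕ) {n : ℕ} (μ : P.obj n) (x : Fin n → P.Schur V),
    g i (P.schurOp V μ x) = ∑ p ∈ piAntidiag univ i, B.op μ fun j => g (p j) (x j)

/-- Monomials are operations applied to generators, so the Cartan formula expresses the family
through its values on generators. -/
theorem CartanFamily.ext {g h : ℕ → P.Schur V →ₗ[F₂] B.carrier} (hg : B.CartanFamily g)
    (hh : B.CartanFamily h)
    (e : ∀ i v, g i (P.mono P.one fun _ => v) = h i (P.mono P.one fun _ => v)) : g = h := by
  funext i
  refine SymmOperad.schur_hom_ext fun n μ v => ?_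
  rw [SymmOperad.mono_eq_schurOp, hg, hh]
  simp only [e]

/-- The terms `∑ μ(f_{i₁} v₁, …, f_{iₙ} vₙ)`, the sum being over `i₁ + ⋯ + iₙ = i`. -/
def cartanArity (hB : B.IsAlgebra) (f : ℕ → V →ₗ[F₂] B.carrier) (i n : ℕ) :
    P.obj n →ₗ[F₂] MultilinearMap F₂ (fun _ : Fin n => V) B.carrier where
  toFun μ := ∑ p ∈ piAntidiag univ i, (B.op μ).compLinearMap fun j => f (p j)
  map_add' μ ν := by
    ext v
    simp only [_root_.sum_apply, MultilinearMap.compLinearMap_apply, hB.op_add,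
      sum_add_distrib, add_apply]
  map_smul' c μ := by
    ext v
    simp only [_root_.sum_apply, MultilinearMap.compLinearMap_apply, hB.op_smul,
      RingHom.id_apply, smul_apply, smul_sum]

theorem cartanArity_apply (hB : B.IsAlgebra) (f : ℕ → V →ₗ[F₂] B.carrier) (i : ℕ) {n : ℕ}
    (μ : P.obj n) (v : Fin n → V) :
    cartanArity hB f i n μ v = ∑ p ∈ piAntidiag univ i, B.op μ fun j => f (p j) (v j) := by
  simp [cartanArity]

theorem cartanArity_rel (hB : B.IsAlgebra) (f : ℕ → V →ₗ[F₂] B.carrier) (i : ℕ) {n : ℕ}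
    (σ : Fin n ≃ Fin n) (μ : P.obj n) (v : Fin n → V) :
    cartanArity hB f i n (P.rel σ μ) v = cartanArity hB f i n μ (v ∘ σ) := by
  simp only [cartanArity_apply, hB.op_rel]
  refine sum_nbij' (fun p => p ∘ σ) (fun p => p ∘ σ.symm) ?_ ?_ ?_ ?_ ?_
  · intro p hp
    simp only [mem_piAntidiag, mem_univ, implies_true, and_true] at hp ⊢
    rw [← hp]; exact Equiv.sum_comp σ p
  · intro p hp
    simp only [mem_piAntidiag, mem_univ, implies_true, and_true] at hp ⊢
    rw [← hp]; exact Equiv.sum_comp σ.symm p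
  · intro p _; funext j; simp
  · intro p _; funext j; simp
  · intro p _; rfl

/-- The family of maps from `S(P, V)` that extends a family of maps from `V` by the Cartan
formula. -/
def cartanExt (hB : B.IsAlgebra) (f : ℕ → V →ₗ[F₂] B.carrier) (i : ℕ) :
    P.Schur V →ₗ[F₂] B.carrier :=
  DirectSum.toModule F₂ ℕ _ fun n =>
    P.arityLift (cartanArity hB f i n) (cartanArity_rel hB f i)

theorem cartanExt_mono (hB : B.IsAlgebra) (f : ℕ → V →ₗ[F₂] B.carrier) (i : ℕ) {n : ℕ}
    (μ : P.obj n) (v : Fin n → V) :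
    cartanExt hB f i (P.mono μ v) =
      ∑ p ∈ piAntidiag univ i, B.op μ fun j => f (p j) (v j) := by
  rw [cartanExt, SymmOperad.mono, DirectSum.toModule_lof, SymmOperad.arityLift_mono,
    cartanArity_apply]

theorem sum_piAntidiag_fin_one {Z : Type*} [AddCommMonoid Z] (G : (Fin 1 → ℕ) → Z) (i : ℕ) :
    ∑ p ∈ piAntidiag univ i, G p = G fun _ => i := by
  refine sum_eq_single_of_mem _ (by simp) fun p hp hne => ?_
  refine absurd (funext fun j => ?_) hne
  rw [Subsingleton.elim j 0]
  simpa using hp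

theorem cartanExt_one (hB : B.IsAlgebra) (f : ℕ → V →ₗ[F₂] B.carrier) (i : ℕ) (v : V) :
    cartanExt hB f i (P.mono P.one fun _ => v) = f i v := by
  rw [cartanExt_mono, sum_piAntidiag_fin_one, hB.op_one]

theorem cartanExt_cartan (hB : B.IsAlgebra) (f : ℕ → V →ₗ[F₂] B.carrier) :
    B.CartanFamily (cartanExt hB f) := by
  intro i n μ x
  induction x using SymmOperad.schur_pi_induction with
  | zero x l =>
    simp only [Function.apply_update (fun _ => cartanExt hB f _), MultilinearMap.map_update_zero]
    rw [map_zero]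
    refine (sum_eq_zero fun p _ => ?_).symm
    refine (B.op μ).map_coord_zero l ?_
    simp
  | add x l a b ha hb =>
    have hu : ∀ (p : Fin n → ℕ) c, (fun j => cartanExt hB f (p j) (Function.update x l c j)) =
        Function.update (fun j => cartanExt hB f (p j) (x j)) l (cartanExt hB f (p l) c) :=
      fun p c => funext fun j => Function.apply_update (fun j => cartanExt hB f (p j)) x l c j
    simp only [hu, MultilinearMap.map_update_add, map_add, sum_add_distrib] at ha hb ⊢
    rw [ha, hb]
  | mono k ν v =>
    rw [SymmOperad.schurOp_mono, cartanExt_mono]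
    simp only [hB.op_comp, SymmOperad.concat_apply, cartanExt_mono]
    -- On monomials the left side is a sum over the inputs of the composite. Grouping it by blocks
    -- gives the sum over `q` of the Cartan sums of the inner operations.
    rw [sum_piAntidiag_sigma k (fun r => B.op μ fun a => B.op (ν a) fun b => f (r a b) (v a b))]
    refine sum_congr rfl fun q _ => ?_
    rw [MultilinearMap.map_sum_finset]

/-- The morphism of algebras from `S(P, V)` that extends a linear map from `V`. -/
def homExt (hB : B.IsAlgebra) (f : V →ₗ[F₂] B.carrier) : P.Schur V →ₗ[F₂] B.carrier :=
  -- The only decomposition of `0` is the zero one, so the Cartan formula in degree `0` says that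
  -- the map commutes with the operations.
  cartanExt hB (fun _ => f) 0

theorem homExt_one (hB : B.IsAlgebra) (f : V →ₗ[F₂] B.carrier) (v : V) :
    homExt hB f (P.mono P.one fun _ => v) = f v :=
  cartanExt_one hB _ 0 v

theorem homExt_op (hB : B.IsAlgebra) (f : V →ₗ[F₂] B.carrier) {n : ℕ} (μ : P.obj n)
    (x : Fin n → P.Schur V) :
    homExt hB f (P.schurOp V μ x) = B.op μ fun j => homExt hB f (x j) := by
  rw [homExt, cartanExt_cartan, piAntidiag_zero, sum_singleton]
  rfl

theorem homExt_mono (hB : B.IsAlgebra) (f : V →ₗ[F₂] B.carrier) {n : ℕ} (μ : P.obj n)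
    (v : Fin n → V) : homExt hB f (P.mono μ v) = B.op μ fun j => f (v j) := by
  rw [homExt, cartanExt_mono, piAntidiag_zero, sum_singleton]

/-- A morphism of algebras followed by a family of operators that satisfies the Cartan formula. -/
theorem CartanFamily.comp_hom {sq : ℕ → Module.End F₂ B.carrier} (h : B.Cartan sq)
    {φ : P.Schur V →ₗ[F₂] B.carrier}
    (hφ : ∀ {n : ℕ} (μ : P.obj n) (x : Fin n → P.Schur V),
      φ (P.schurOp V μ x) = B.op μ fun j => φ (x j)) :
    B.CartanFamily fun i => sq i ∘ₗ φ := by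
  intro i n μ x
  simp only [LinearMap.comp_apply, hφ]
  rw [h]

/-- A family of operators that satisfies the Cartan formula followed by a morphism of algebras. -/
theorem CartanFamily.hom_comp {sq : ℕ → Module.End F₂ (P.Schur V)}
    (h : ∀ (i : ℕ) {n : ℕ} (μ : P.obj n) (x : Fin n → P.Schur V),
      sq i (P.schurOp V μ x) = ∑ p ∈ piAntidiag univ i, P.schurOp V μ fun j => sq (p j) (x j))
    {φ : P.Schur V →ₗ[F₂] B.carrier}
    (hφ : ∀ {n : ℕ} (μ : P.obj n) (x : Fin n → P.Schur V),
      φ (P.schurOp V μ x) = B.op μ fun j => φ (x j)) :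
    B.CartanFamily fun i => φ ∘ₗ sq i := by
  intro i n μ x
  simp only [LinearMap.comp_apply, h, map_sum, hφ]

/-- The inclusion of the generators, as a linear map. -/
def unitₗ (P : SymmOperad) (V : Type*) [AddCommGroup V] [Module F₂ V] : V →ₗ[F₂] P.Schur V where
  toFun v := P.mono P.one fun _ => v
  map_add' a b := by
    have h := (P.monoₗ V 1 P.one).map_update_add (fun _ => 0) 0 a b
    simp only [Function.update_eq_const_of_subsingleton] at h
    exact h
  map_smul' c a := by
    have h := (P.monoₗ V 1 P.one).map_update_smul (fun _ => 0) 0 c a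
    simp only [Function.update_eq_const_of_subsingleton] at h
    exact h

theorem schurAlgebra_cartan (M : SqSpace) : (P.schurAlgebra M).Cartan (P.schurAlgebra M).sq := by
  have h := P.schurAlgebra_isAlgebra M
  let f : ℕ → M.carrier →ₗ[F₂] (P.schurAlgebra M).carrier := fun i => unitₗ P M.carrier ∘ₗ M.sq i
  -- The squares of `S(P, M)` are the Cartan extension of those of `M`, so the formula, known on
  -- monomials over `M`, holds for arbitrary arguments.
  have key : (P.schurAlgebra M).sq = cartanExt h f := by
    funext i
    refine SymmOperad.schur_hom_ext fun n μ v => ?_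
    rw [cartanExt_mono]
    refine (P.schurSq_mono M.sq i μ v).trans (sum_congr rfl fun p _ => ?_)
    rw [SymmOperad.mono_eq_schurOp]
    rfl
  rw [key]
  exact cartanExt_cartan h f

end SqAlgebra

/-! ### Steenrod operations on the free algebra on a class of degree one -/

/-- Operators that satisfy the Adem relations define an action of the Steenrod algebra. -/
theorem exists_steenrod_action {W : Type*} [AddCommGroup W] [Module F₂ W]
    (sq : ℕ → Module.End F₂ W) (h0 : sq 0 = 1)
    (h : ∀ i j : ℕ, 0 < i → 0 < j → i < 2 * j → sq i * sq j =
      ∑ k ∈ Finset.range (i / 2 + 1),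
        ((j - k - 1).choose (i - 2 * k) : F₂) • (sq (i + j - k) * sq k)) :
    ∃ ρ : SteenrodAlgebra →ₐ[F₂] Module.End F₂ W, ∀ i, ρ (SteenrodAlgebra.Sq i) = sq i := by
  let f : FreeAlgebra F₂ ℕ+ →ₐ[F₂] Module.End F₂ W := FreeAlgebra.lift F₂ fun i => sq i
  have hf : ∀ i, f (freeSq i) = sq i := by
    intro i
    unfold freeSq
    split_ifs with hi
    · exact FreeAlgebra.lift_ι_apply (R := F₂) (fun i : ℕ+ => sq i) ⟨i, hi⟩
    · obtain rfl : i = 0 := by omega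
      simp [h0]
  refine ⟨RingQuot.liftAlgHom F₂ ⟨f, ?_⟩, fun i => ?_⟩
  · rintro _ _ ⟨i, j, hi, hj, hij⟩
    simp only [map_mul, map_sum, map_smul, hf]
    exact h i j hi hj hij
  · rw [SteenrodAlgebra.Sq, RingQuot.liftAlgHom_mkAlgHom_apply, hf]

theorem sum_piAntidiag_fin_two {Z : Type*} [AddCommMonoid Z] (G : (Fin 2 → ℕ) → Z) (i : ℕ) :
    ∑ p ∈ Finset.piAntidiag Finset.univ i, G p =
      ∑ p ∈ Finset.HasAntidiagonal.antidiagonal i, G ![p.1, p.2] := by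
  refine Finset.sum_nbij' (fun p => (p 0, p 1)) (fun p => ![p.1, p.2]) ?_ ?_ ?_ ?_ ?_
  · intro p hp; simpa using hp
  · intro p hp; simpa using hp
  · intro p _; funext j; fin_cases j <;> rfl
  · intro p _; rfl
  · intro p _
    congr 1
    funext j; fin_cases j <;> rfl

theorem SqSpace.isInternal_deg (M : SqSpace) (h : iSupIndep M.deg) (h' : iSup M.deg = ⊤) :
    DirectSum.IsInternal M.deg :=
  DirectSum.isInternal_submodule_of_iSupIndep_of_iSup_eq_top h h'

theorem coeff_ademSeries_zero (a b : ℕ) :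
    PowerSeries.coeff b (PowerSeries.coeff a (ademSeries 0)) =
      if a = 0 then (if b = 0 then 1 else 0) else 0 := by
  simp only [ademSeries, Matrix.cons_val, PowerSeries.coeff_one]
  split_ifs <;> simp_all [PowerSeries.coeff_one]

theorem coeff_ademSeries_one (a b : ℕ) :
    PowerSeries.coeff b (PowerSeries.coeff a (ademSeries 1)) =
      if a = 0 then (if b = 1 then 1 else 0) else
        if a = 1 then (if b = 0 then 1 else 0) else 0 := by
  simp only [ademSeries, Matrix.cons_val, map_add, PowerSeries.coeff_X, PowerSeries.coeff_C]
  split_ifs <;> simp_all [PowerSeries.coeff_one, PowerSeries.coeff_X]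

theorem coeff_ademSeries_two (a b : ℕ) :
    PowerSeries.coeff b (PowerSeries.coeff a (ademSeries 2)) =
      if a = 2 then (if b = 1 then 1 else 0) else 0 := by
  simp only [ademSeries, Matrix.cons_val, PowerSeries.coeff_mul_C, PowerSeries.coeff_X_pow]
  split_ifs <;> simp_all [PowerSeries.coeff_X]

namespace SqAlgebra

open Finset

variable {P : SymmOperad}

/-- A graded algebra that is generated by a class `ι` of degree one, each homogeneous element of
degree `d` being given by an operation of arity `d`, with operations that satisfy the Cartan formula
and have the values `ι`, `⋆(ι, ι)`, `0`, `0`, … on `ι`. -/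
structure IsGeneratedByLine (B : SqAlgebra P) (star : P.obj 2) (ι : B.carrier) : Prop where
  isAlgebra : B.IsAlgebra
  cartan : B.Cartan B.sq
  sq_zero : B.sq 0 ι = ι
  sq_one : B.sq 1 ι = B.op star ![ι, ι]
  sq_of_two_le : ∀ j, 2 ≤ j → B.sq j ι = 0
  mem_deg : ∀ d x, x ∈ B.deg d ↔ ∃ μ : P.obj d, x = B.op μ fun _ => ι
  graded : DirectSum.IsInternal B.deg

/-! ### An algebra generated by a line is `⋆`-unstable. -/

namespace IsGeneratedByLine

variable {B : SqAlgebra P} {star : P.obj 2} {ι : B.carrier}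

theorem hom_ext (h : B.IsGeneratedByLine star ι) {Z : Type*}
    [AddCommGroup Z] [Module F₂ Z] {f g : B.carrier →ₗ[F₂] Z}
    (hfg : ∀ (n : ℕ) (μ : P.obj n), f (B.op μ fun _ => ι) = g (B.op μ fun _ => ι)) : f = g := by
  have hle : ⨆ d, B.deg d ≤ LinearMap.eqLocus f g := by
    refine iSup_le fun d x hx => ?_
    obtain ⟨μ, rfl⟩ := (h.mem_deg d x).1 hx
    exact hfg d μ
  rw [h.graded.submodule_iSup_eq_top] at hle
  exact LinearMap.ext fun x => hle trivial

theorem sq_zero_eq_one (h : B.IsGeneratedByLine star ι) : B.sq 0 = 1 := by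
  refine h.hom_ext fun n μ => ?_
  rw [h.cartan, piAntidiag_zero, sum_singleton]
  simp only [Pi.zero_apply, h.sq_zero]
  rfl

/-- The values of the iterated squares `Sqᵃ Sqᵇ` on the generator. -/
theorem sq_sq (h : B.IsGeneratedByLine star ι) (hcomm : P.IsCommutative star)
    (a b : ℕ) :
    B.sq a (B.sq b ι) =
      ∑ c, PowerSeries.coeff b (PowerSeries.coeff a (ademSeries c)) •
        (![ι, B.sq 1 ι, B.op star ![B.sq 1 ι, B.sq 1 ι]] : Fin 3 → B.carrier) c := by
  have hsymm : ∀ x y : B.carrier, B.op star ![x, y] = B.op star ![y, x] := by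
    intro x y
    have := h.isAlgebra.op_rel (Equiv.swap 0 1) star ![x, y]
    rw [hcomm] at this
    rw [this]
    congr 1
    funext j; fin_cases j <;> rfl
  have hzl : ∀ x : B.carrier, B.op star ![0, x] = 0 :=
    fun x => MultilinearMap.map_coord_zero _ 0 rfl
  have hzr : ∀ x : B.carrier, B.op star ![x, 0] = 0 :=
    fun x => MultilinearMap.map_coord_zero _ 1 rfl
  rw [Fin.sum_univ_three, coeff_ademSeries_zero, coeff_ademSeries_one, coeff_ademSeries_two]
  simp only [Matrix.cons_val]
  match b with
  | 0 =>
    rw [h.sq_zero]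
    match a with
    | 0 => simp [h.sq_zero]
    | 1 => simp
    | a + 2 => simp [h.sq_of_two_le]
  | 1 =>
    rw [show B.sq a (B.sq 1 ι) = B.sq a (B.op star ![ι, ι]) by rw [h.sq_one], h.cartan,
      sum_piAntidiag_fin_two]
    have hvec : ∀ p q : ℕ, (fun j => B.sq ((![p, q] : Fin 2 → ℕ) j)
        ((![ι, ι] : Fin 2 → B.carrier) j)) = ![B.sq p ι, B.sq q ι] := by
      intro p q; funext j; fin_cases j <;> rfl
    simp only [hvec]
    match a with
    | 0 =>
      rw [show HasAntidiagonal.antidiagonal 0 = {(0, 0)} from rfl, sum_singleton]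
      simp [h.sq_zero, h.sq_one]
    | 1 =>
      rw [Nat.sum_antidiagonal_succ]
      rw [show HasAntidiagonal.antidiagonal 0 = {(0, 0)} from rfl, sum_singleton]
      -- The Cartan terms are `⋆(ι, Sq¹ι)` and `⋆(Sq¹ι, ι)`; commutativity of `⋆` makes them equal,
      -- so they cancel modulo 2.
      rw [hsymm]
      simp [← two_smul F₂, show (2 : F₂) = 0 from rfl]
    | 2 =>
      rw [Nat.sum_antidiagonal_succ, Nat.sum_antidiagonal_succ]
      rw [show HasAntidiagonal.antidiagonal 0 = {(0, 0)} from rfl, sum_singleton]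
      -- Only the splitting `2 = 1 + 1` survives, and it gives the third basis vector, with
      -- coefficient the one of `u² v`.
      simp [h.sq_of_two_le, hzl, hzr]
    | a + 3 =>
      rw [sum_eq_zero]
      · simp
      · rintro ⟨p, q⟩ hpq
        rw [HasAntidiagonal.mem_antidiagonal] at hpq
        rcases le_or_gt 2 p with hp | hp
        · rw [h.sq_of_two_le p hp, hzl]
        · rw [h.sq_of_two_le q (by omega), hzr]
  | b + 2 =>
    rw [h.sq_of_two_le _ (by omega), map_zero]
    simp

/-- Both sides are tested on `μ(ι, …, ι)`, where two applications of the Cartan formula produce the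
double sums governed by `sq_sq`. -/
theorem adem (h : B.IsGeneratedByLine star ι) (hcomm : P.IsCommutative star)
    (i j : ℕ) (hij : i < 2 * j) :
    B.sq i * B.sq j =
      ∑ k ∈ range (i / 2 + 1), ((j - k - 1).choose (i - 2 * k) : F₂) •
        (B.sq (i + j - k) * B.sq k) := by
  refine h.hom_ext fun n μ => ?_
  have hiter : ∀ i j : ℕ, B.sq i (B.sq j (B.op μ fun _ => ι)) =
      ∑ p ∈ piAntidiag univ j, ∑ q ∈ piAntidiag univ i,
        B.op μ fun l => B.sq (q l) (B.sq (p l) ι) := by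
    intro i j
    rw [h.cartan, map_sum]
    exact sum_congr rfl fun p _ => h.cartan i μ _
  simp only [LinearMap.sum_apply, LinearMap.smul_apply, Module.End.mul_apply, hiter]
  exact sum_piAntidiag_adem (B.op μ) _ (fun a b => B.sq a (B.sq b ι)) (h.sq_sq hcomm) i j hij

theorem sq_mem (h : B.IsGeneratedByLine star ι) (i d : ℕ) (x : B.carrier)
    (hx : x ∈ B.deg d) : B.sq i x ∈ B.deg (d + i) := by
  have hι : ∀ k, B.sq k ι ∈ B.deg (1 + k) := by
    intro k
    match k with
    | 0 =>
      rw [h.sq_zero]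
      exact (h.mem_deg 1 _).2 ⟨P.one, (h.isAlgebra.op_one fun _ => ι).symm⟩
    | 1 =>
      rw [h.sq_one]
      refine (h.mem_deg 2 _).2 ⟨star, ?_⟩
      congr 1
      funext j; fin_cases j <;> rfl
    | k + 2 =>
      rw [h.sq_of_two_le _ (by omega)]
      exact Submodule.zero_mem _
  obtain ⟨μ, rfl⟩ := (h.mem_deg d x).1 hx
  rw [h.cartan]
  refine Submodule.sum_mem _ fun p hp => ?_
  have hp' : ∑ j, p j = i := by simpa using hp
  have := h.isAlgebra.op_mem μ (fun j => 1 + p j) _ fun j => hι (p j)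
  rwa [sum_add_distrib, hp', sum_const, card_univ, Fintype.card_fin, smul_eq_mul, mul_one] at this

theorem sq_eq_zero (h : B.IsGeneratedByLine star ι) (i d : ℕ) (x : B.carrier)
    (hx : x ∈ B.deg d) (hi : d < i) : B.sq i x = 0 := by
  obtain ⟨μ, rfl⟩ := (h.mem_deg d x).1 hx
  rw [h.cartan]
  refine sum_eq_zero fun p hp => ?_
  have hp' : ∑ j, p j = i := by simpa using hp
  -- Pigeonhole: `d` exponents with sum `i > d` cannot all be at most `1`.
  obtain ⟨j, hj⟩ : ∃ j, 2 ≤ p j := by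
    by_contra! hlt
    have : ∑ j, p j ≤ ∑ _j : Fin d, 1 := sum_le_sum fun j _ => Nat.lt_succ_iff.1 (hlt j)
    simp only [sum_const, card_univ, Fintype.card_fin, smul_eq_mul, mul_one] at this
    omega
  exact MultilinearMap.map_coord_zero _ j (h.sq_of_two_le _ hj)

/-- The top operation is the square `⋆(x, x)`. -/
theorem sq_top (h : B.IsGeneratedByLine star ι) (hcentral : P.IsCentral star)
    (d : ℕ) (x : B.carrier) (hx : x ∈ B.deg d) :
    B.sq d x = B.op star ![x, x] := by
  have hconst : ∀ x : B.carrier, (fun _ : Fin 2 => x) = ![x, x] := by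
    intro x; funext j; fin_cases j <;> rfl
  obtain ⟨μ, rfl⟩ := (h.mem_deg d x).1 hx
  -- Any other choice of `d` exponents with sum `d` contains one that is at least `2`, which kills
  -- its term.
  rw [h.cartan, sum_eq_single_of_mem (fun _ => 1) (by simp)]
  -- Centrality is evaluated on the constant family `ι`, which the shuffle of inputs does not
  -- change.
  · have hc := congrArg (fun ξ => B.op ξ fun _ => ι) (hcentral d μ)
    beta_reduce at hc
    rw [h.isAlgebra.op_comp, h.isAlgebra.op_rel, hconst] at hc
    simp only [h.sq_one, ← hconst] at hc ⊢
    rw [hc]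
    exact (h.isAlgebra.op_comp (fun _ : Fin d => 2) μ (fun _ => star) fun _ => ι).symm
  · intro p hp hne
    have hp' : ∑ j, p j = d := by simpa using hp
    obtain ⟨j, hj⟩ : ∃ j, 2 ≤ p j := by
      by_contra! hlt
      have hle : ∀ j ∈ univ, p j ≤ 1 := fun j _ => Nat.lt_succ_iff.1 (hlt j)
      refine hne (funext fun j => (sum_eq_sum_iff_of_le hle).1 ?_ j (mem_univ j))
      simpa using hp'
    exact MultilinearMap.map_coord_zero _ j (h.sq_of_two_le _ hj)

theorem isStarUnstable (h : B.IsGeneratedByLine star ι)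
    (hcomm : P.IsCommutative star) (hcentral : P.IsCentral star) :
    B.IsStarUnstable star where
  isUnstable :=
    { graded := h.graded
      action := exists_steenrod_action B.sq h.sq_zero_eq_one
        fun i j _ _ hij => h.adem hcomm i j hij
      sq_mem := h.sq_mem
      sq_eq_zero := h.sq_eq_zero }
  isAlgebra := h.isAlgebra
  cartan := h.cartan
  sq_top := h.sq_top hcentral

end IsGeneratedByLine

end SqAlgebra

/-! ### The model: the free algebra on a class of degree one. -/

namespace SymmOperad

open Finset SqAlgebra

variable {P : SymmOperad}

/-- A homogeneous element of degree `d` of the free algebra on a class of degree one is given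
by an operation of arity `d`. -/
theorem mem_schurDeg_lineDeg {d : ℕ} {x : P.Schur F₂} :
    x ∈ P.schurDeg lineDeg d ↔ ∃ μ : P.obj d, x = P.mono μ fun _ => 1 := by
  constructor
  · intro hx
    induction hx using Submodule.span_induction with
    | mem x hx =>
      obtain ⟨n, μ, v, e, hv, rfl, rfl⟩ := hx
      by_cases h : ∃ i, v i = 0
      · obtain ⟨i, hi⟩ := h
        refine ⟨0, ?_⟩
        rw [← monoₗ_apply, ← monoₗ_apply, map_zero, (P.monoₗ F₂ n μ).map_coord_zero i hi]
        rfl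
      · push Not at h
        have hv1 : v = fun _ => 1 :=
          funext fun i => ((by decide : ∀ r : F₂, r = 0 ∨ r = 1) (v i)).resolve_left (h i)
        have he : e = fun _ => 1 := by
          funext i
          by_contra hne
          have := hv i
          rw [lineDeg, if_neg hne, Submodule.mem_bot] at this
          exact h i this
        subst hv1 he
        -- The degree is the sum of `n` ones, equal to `n` only propositionally; relabelling along
        -- the cast moves `μ` to the required arity.
        have hn : n = ∑ _i : Fin n, 1 := by simp
        refine ⟨P.rel (finCongr hn) μ, ?_⟩
        rw [mono_rel]
        rfl
    | zero => exact ⟨0, by rw [← monoₗ_apply, map_zero]; rfl⟩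
    | add x y _ _ hx hy =>
      obtain ⟨μ, rfl⟩ := hx
      obtain ⟨ν, rfl⟩ := hy
      exact ⟨μ + ν, by rw [← monoₗ_apply, ← monoₗ_apply, ← monoₗ_apply, map_add]; rfl⟩
    | smul c x _ hx =>
      obtain ⟨μ, rfl⟩ := hx
      exact ⟨c • μ, by rw [← monoₗ_apply, ← monoₗ_apply, map_smul]; rfl⟩
  · rintro ⟨μ, rfl⟩
    exact Submodule.subset_span ⟨d, μ, fun _ => 1, fun _ => 1, fun _ => by simp [lineDeg],
      by simp, rfl⟩

/-- Degree and arity coincide here, so the grading inherits its independence from the direct sum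
over arities. -/
theorem component_eq_zero_of_mem_schurDeg_lineDeg {d j : ℕ} (h : d ≠ j) {x : P.Schur F₂}
    (hx : x ∈ P.schurDeg lineDeg d) : DirectSum.component F₂ ℕ (P.SchurArity F₂) j x = 0 := by
  obtain ⟨μ, rfl⟩ := mem_schurDeg_lineDeg.1 hx
  rw [mono, DirectSum.component.of, dif_neg h]

theorem schurDeg_lineDeg_iSupIndep : iSupIndep (P.schurDeg lineDeg) := by
  intro d
  rw [Submodule.disjoint_def]
  intro x hx hx'
  have hle : ⨆ j, ⨆ (_ : j ≠ d), P.schurDeg lineDeg j ≤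
      LinearMap.ker (DirectSum.component F₂ ℕ (P.SchurArity F₂) d) := by
    refine iSup_le fun j => iSup_le fun hj y hy => ?_
    exact component_eq_zero_of_mem_schurDeg_lineDeg hj hy
  refine DirectSum.ext_component F₂ fun j => ?_
  rw [map_zero]
  by_cases hj : d = j
  · subst hj; exact LinearMap.mem_ker.1 (hle hx')
  · exact component_eq_zero_of_mem_schurDeg_lineDeg hj hx

theorem iSup_schurDeg_lineDeg : ⨆ d, P.schurDeg lineDeg d = ⊤ := by
  rw [eq_top_iff]
  rintro x -
  induction x using schur_induction with
  | zero => exact Submodule.zero_mem _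
  | add x y hx hy => exact Submodule.add_mem _ hx hy
  | mono n μ v =>
    refine Submodule.mem_iSup_of_mem n (Submodule.subset_span ⟨n, μ, v, fun _ => 1, ?_, ?_, rfl⟩)
    · intro i; simp [lineDeg]
    · simp

/-- The generator of the free algebra on a class of degree one. -/
def lineClass (P : SymmOperad) : P.Schur F₂ := P.mono P.one fun _ => 1

theorem mono_line {n : ℕ} (μ : P.obj n) :
    (P.mono μ fun _ => (1 : F₂)) = P.schurOp F₂ μ fun _ => lineClass P :=
  mono_eq_schurOp μ _

/-- The Steenrod squares of the generator of degree one. -/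
def lineSq (star : P.obj 2) : ℕ → P.Schur F₂
  | 0 => lineClass P
  | 1 => P.schurOp F₂ star ![lineClass P, lineClass P]
  | _ + 2 => 0

/-- The free algebra on a class of degree one, with the Steenrod operations determined by `lineSq`
and the Cartan formula. -/
def lineAlgebra (star : P.obj 2) : SqAlgebra P where
  carrier := P.Schur F₂
  deg := P.schurDeg lineDeg
  sq := cartanExt (P.schurAlgebra_isAlgebra ⟨F₂, lineDeg, 0⟩)
    fun i => LinearMap.toSpanSingleton F₂ (P.Schur F₂) (lineSq star i)
  op μ := P.schurOp F₂ μ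

variable (star : P.obj 2)

theorem lineAlgebra_isAlgebra : (lineAlgebra star).IsAlgebra where
  op_add := schurOp_add
  op_smul := schurOp_smul
  op_rel := schurOp_rel
  op_one := schurOp_one
  op_comp := schurOp_comp
  op_mem := schurOp_mem lineDeg

theorem lineAlgebra_sq_lineClass (i : ℕ) :
    (lineAlgebra star).sq i (lineClass P) = lineSq star i :=
  (cartanExt_one (P.schurAlgebra_isAlgebra ⟨F₂, lineDeg, 0⟩) _ i 1).trans (one_smul F₂ _)

theorem lineAlgebra_graded : DirectSum.IsInternal (lineAlgebra star).deg :=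
  have h : iSupIndep (lineAlgebra star).deg := schurDeg_lineDeg_iSupIndep
  have h' : iSup (lineAlgebra star).deg = ⊤ := iSup_schurDeg_lineDeg
  SqSpace.isInternal_deg _ h h'

theorem lineAlgebra_mem_deg (d : ℕ) (x : P.Schur F₂) : x ∈ P.schurDeg lineDeg d ↔
    ∃ μ : P.obj d, x = P.schurOp F₂ μ fun _ => lineClass P := by
  refine mem_schurDeg_lineDeg.trans (exists_congr fun μ => ?_)
  rw [mono_line]

theorem lineAlgebra_cartan : (lineAlgebra star).Cartan (lineAlgebra star).sq :=
  cartanExt_cartan (P.schurAlgebra_isAlgebra ⟨F₂, lineDeg, 0⟩) _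

theorem lineAlgebra_isGeneratedByLine :
    (lineAlgebra star).IsGeneratedByLine star (lineClass P) where
  isAlgebra := lineAlgebra_isAlgebra star
  cartan := lineAlgebra_cartan star
  sq_zero := lineAlgebra_sq_lineClass star 0
  sq_one := lineAlgebra_sq_lineClass star 1
  sq_of_two_le j hj := by
    obtain ⟨k, rfl⟩ := Nat.exists_eq_add_of_le' hj
    exact lineAlgebra_sq_lineClass star (k + 2)
  mem_deg := lineAlgebra_mem_deg
  graded := lineAlgebra_graded star

end SymmOperad

/-! ### Quotients and isomorphisms of algebras -/

namespace SqAlgebra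

open Finset

variable {P : SymmOperad} {A : SqAlgebra P}

theorem quotient_op (I : Submodule F₂ A.carrier) (hI : A.IsIdeal I) {n : ℕ} (μ : P.obj n)
    (x : Fin n → A.carrier) :
    (A.quotient I hI).op μ (fun j => I.mkQ (x j)) = I.mkQ (A.op μ x) := by
  apply MultilinearLift.lift_apply (fun _ : Fin n => I.mkQ)
  intro x i a ha
  rw [Submodule.mkQ_apply, Submodule.Quotient.mk_eq_zero] at ha
  exact (Submodule.Quotient.mk_eq_zero I).2 (hI.op_mem μ _ i (by simpa using ha))

theorem quotient_sq (I : Submodule F₂ A.carrier) (hI : A.IsIdeal I) (i : ℕ) (x : A.carrier) :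
    (A.quotient I hI).sq i (I.mkQ x) = I.mkQ (A.sq i x) :=
  rfl

theorem exists_lift (I : Submodule F₂ A.carrier) {n : ℕ} (x : Fin n → A.carrier ⧸ I) :
    ∃ y : Fin n → A.carrier, x = fun j => I.mkQ (y j) := by
  choose y hy using fun j => I.mkQ_surjective (x j)
  exact ⟨y, funext fun j => (hy j).symm⟩

theorem IsAlgebra.quotient (hA : A.IsAlgebra) (I : Submodule F₂ A.carrier) (hI : A.IsIdeal I) :
    (A.quotient I hI).IsAlgebra where
  op_add μ ν x := by
    obtain ⟨y, rfl⟩ := exists_lift I x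
    rw [quotient_op, quotient_op, quotient_op, hA.op_add, map_add]
    rfl
  op_smul c μ x := by
    obtain ⟨y, rfl⟩ := exists_lift I x
    rw [quotient_op, quotient_op, hA.op_smul, map_smul]
    rfl
  op_rel e μ x := by
    obtain ⟨y, rfl⟩ := exists_lift I x
    rw [quotient_op, hA.op_rel]
    exact (quotient_op I hI μ (y ∘ e)).symm
  op_one x := by
    obtain ⟨y, rfl⟩ := exists_lift I x
    rw [quotient_op, hA.op_one]
  op_comp k μ ν x := by
    obtain ⟨y, rfl⟩ := exists_lift I x
    rw [quotient_op, hA.op_comp, ← quotient_op I hI μ]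
    congr 1
    funext i
    exact (quotient_op I hI (ν i) _).symm
  op_mem μ e x hx := by
    choose y hy hxy using hx
    obtain rfl : (fun j => I.mkQ (y j)) = x := funext hxy
    rw [quotient_op]
    exact ⟨_, hA.op_mem μ e y hy, rfl⟩

theorem Cartan.quotient (hA : A.Cartan A.sq) (I : Submodule F₂ A.carrier) (hI : A.IsIdeal I) :
    (A.quotient I hI).Cartan (A.quotient I hI).sq := by
  intro i n μ x
  obtain ⟨y, rfl⟩ := exists_lift I x
  rw [quotient_op, quotient_sq, hA, map_sum]
  refine sum_congr rfl fun p _ => ?_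
  exact (quotient_op I hI μ _).symm

theorem homExt_mem_deg {V : Type*} [AddCommGroup V] [Module F₂ V] (hA : A.IsAlgebra)
    (deg : ℕ → Submodule F₂ V) (f : V →ₗ[F₂] A.carrier) (hf : ∀ d, ∀ v ∈ deg d, f v ∈ A.deg d)
    (d : ℕ) (x : P.Schur V) (hx : x ∈ P.schurDeg deg d) : homExt hA f x ∈ A.deg d := by
  induction hx using Submodule.span_induction with
  | zero => rw [map_zero]; exact Submodule.zero_mem _
  | add x y _ _ hx hy => rw [map_add]; exact Submodule.add_mem _ hx hy
  | smul c x _ hx => rw [map_smul]; exact Submodule.smul_mem _ _ hx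
  | mem x hx =>
    obtain ⟨n, μ, v, e, hv, rfl, rfl⟩ := hx
    rw [homExt_mono]
    exact hA.op_mem μ e _ fun i => hf _ _ (hv i)

namespace IsGeneratedByLine

variable {B : SqAlgebra P} {star : P.obj 2} {ι : A.carrier}

/-- A morphism of algebras commutes with operations that satisfy the Cartan formula, if it does
on the generator. -/
theorem map_sq (h : A.IsGeneratedByLine star ι) {sq : ℕ → Module.End F₂ B.carrier}
    (hsq : B.Cartan sq) (φ : A.carrier →ₗ[F₂] B.carrier)
    (hop : ∀ {n : ℕ} (μ : P.obj n) x, φ (A.op μ x) = B.op μ fun j => φ (x j))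
    (hι : ∀ i, φ (A.sq i ι) = sq i (φ ι)) (i : ℕ) (x : A.carrier) :
    φ (A.sq i x) = sq i (φ x) := by
  refine LinearMap.congr_fun (f := φ ∘ₗ A.sq i) (g := sq i ∘ₗ φ) (h.hom_ext fun n μ => ?_) x
  rw [LinearMap.comp_apply, LinearMap.comp_apply, h.cartan, hop, hsq, map_sum]
  simp only [hop, hι]

/-- An isomorphism of graded algebras transports the property of being generated by a class of
degree one. -/
theorem of_equiv (h : A.IsGeneratedByLine star ι) (hB : B.IsAlgebra) (hB' : B.Cartan B.sq)
    (φ : A.carrier ≃ₗ[F₂] B.carrier)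
    (hop : ∀ {n : ℕ} (μ : P.obj n) x, φ (A.op μ x) = B.op μ fun j => φ (x j))
    (hι : ∀ i, φ (A.sq i ι) = B.sq i (φ ι))
    (hdeg : ∀ d, (A.deg d).map φ.toLinearMap = B.deg d) : B.IsGeneratedByLine star (φ ι) where
  isAlgebra := hB
  cartan := hB'
  sq_zero := by rw [← hι, h.sq_zero]
  sq_one := by
    have : (![φ ι, φ ι] : Fin 2 → B.carrier) = fun j => φ ((![ι, ι] : Fin 2 → A.carrier) j) := by
      funext j; fin_cases j <;> rfl
    rw [← hι, h.sq_one, hop, this]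
  sq_of_two_le j hj := by rw [← hι, h.sq_of_two_le j hj, map_zero]
  mem_deg d x := by
    rw [← hdeg]
    constructor
    · rintro ⟨y, hy, rfl⟩
      obtain ⟨μ, rfl⟩ := (h.mem_deg d y).1 hy
      exact ⟨μ, hop μ _⟩
    · rintro ⟨μ, rfl⟩
      exact ⟨_, (h.mem_deg d _).2 ⟨μ, rfl⟩, hop μ _⟩
  graded := by
    have hdeg' : B.deg = fun d => (A.deg d).map φ.toLinearMap := funext fun d => (hdeg d).symm
    refine B.toSqSpace.isInternal_deg ?_ ?_
    · rw [hdeg']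
      exact LinearMap.iSupIndep_map _ φ.injective h.graded.submodule_iSupIndep
    · rw [hdeg', ← Submodule.map_iSup, h.graded.submodule_iSup_eq_top]
      exact (Submodule.map_top _).trans (LinearEquiv.range φ)

end IsGeneratedByLine

end SqAlgebra

/-! ### The free unstable module on one generator -/

section FreeUnstable

variable {M : SqSpace} {n : ℕ}

/-- The projection from the Steenrod algebra to the free unstable module on one generator. -/
def freeUnstableProj (n : ℕ) : SteenrodAlgebra →ₗ[F₂] (freeUnstableModule n).carrier :=
  (excessIdeal n).mkQ.restrictScalars F₂

theorem freeUnstableProj_surjective : Function.Surjective (freeUnstableProj n) :=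
  (excessIdeal n).mkQ_surjective

theorem sq_freeUnstableProj (i : ℕ) (θ : SteenrodAlgebra) :
    (freeUnstableModule n).sq i (freeUnstableProj n θ) =
      freeUnstableProj n (SteenrodAlgebra.Sq i * θ) :=
  rfl

theorem freeUnstableProj_one : freeUnstableProj n 1 = fundamentalClass n :=
  rfl

theorem mem_freeUnstableModule_deg {d : ℕ} {y : (freeUnstableModule n).carrier} :
    y ∈ (freeUnstableModule n).deg d ↔
      y ∈ if n ≤ d then (SteenrodAlgebra.deg (d - n)).map (freeUnstableProj n) else ⊥ :=
  Iff.rfl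

theorem SqSpace.IsUnstable.rho_mem (hM : M.IsUnstable)
    {ρ : SteenrodAlgebra →ₐ[F₂] Module.End F₂ M.carrier}
    (hρ : ∀ i, ρ (SteenrodAlgebra.Sq i) = M.sq i) {d : ℕ} {θ : SteenrodAlgebra}
    (hθ : θ ∈ SteenrodAlgebra.deg d) {x : M.carrier} (hx : x ∈ M.deg n) :
    ρ θ x ∈ M.deg (n + d) := by
  induction hθ using Submodule.span_induction with
  | zero => simp
  | add a b _ _ ha hb => rw [map_add]; exact Submodule.add_mem _ ha hb
  | smul c a _ ha => rw [map_smul]; exact Submodule.smul_mem _ _ ha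
  | mem θ hθ =>
    obtain ⟨I, rfl, rfl⟩ := hθ
    induction I with
    | nil => simpa using hx
    | cons i I ih =>
      rw [List.map_cons, List.prod_cons, map_mul, hρ, List.sum_cons, add_comm i, ← add_assoc]
      exact hM.sq_mem i _ _ ih

/-- The universal property of the free unstable module on one generator. -/
theorem SqSpace.IsUnstable.exists_freeUnstable_lift (hM : M.IsUnstable) {x : M.carrier}
    (hx : x ∈ M.deg n) :
    ∃ f : (freeUnstableModule n).carrier →ₗ[F₂] M.carrier,
      f (fundamentalClass n) = x ∧ (∀ i y, f ((freeUnstableModule n).sq i y) = M.sq i (f y)) ∧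
      ∀ d y, y ∈ (freeUnstableModule n).deg d → f y ∈ M.deg d := by
  obtain ⟨ρ, hρ⟩ := hM.action
  let g : SteenrodAlgebra →+ M.carrier :=
    { toFun := fun θ => ρ θ x
      map_zero' := by simp
      map_add' := fun a b => by simp }
  have hg : (excessIdeal n).toAddSubgroup ≤ g.ker := by
    intro θ hθ
    change θ ∈ excessIdeal n at hθ
    change ρ θ x = 0
    induction hθ using Submodule.span_induction with
    | zero => simp
    | add a b _ _ ha hb => rw [map_add, LinearMap.add_apply, ha, hb, add_zero]
    | smul c a _ ha => rw [smul_eq_mul, map_mul, Module.End.mul_apply, ha, map_zero]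
    | mem θ hθ =>
      obtain ⟨i, d, θ, hθ, hi, rfl⟩ := hθ
      rw [map_mul, hρ, Module.End.mul_apply]
      -- `θ x` has degree `n + d < i`, so instability of `M` kills `Sqⁱ θ x`.
      exact hM.sq_eq_zero i _ _ (hM.rho_mem hρ hθ hx) hi
  -- The excess ideal is a submodule over the Steenrod algebra, whereas an `F₂`-linear map is
  -- wanted. The descent is done for additive groups, where linearity over `ZMod 2` is automatic.
  let f : (freeUnstableModule n).carrier →+ M.carrier :=
    QuotientAddGroup.lift (excessIdeal n).toAddSubgroup g hg
  have hf : ∀ θ, f.toZModLinearMap 2 (freeUnstableProj n θ) = ρ θ x := fun θ => rfl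
  refine ⟨f.toZModLinearMap 2, ?_, ?_, ?_⟩
  · rw [← freeUnstableProj_one, hf, map_one, Module.End.one_apply]
  · intro i y
    obtain ⟨θ, rfl⟩ := freeUnstableProj_surjective y
    rw [sq_freeUnstableProj, hf, hf, map_mul, hρ, Module.End.mul_apply]
  · intro d y hy
    rw [mem_freeUnstableModule_deg] at hy
    split_ifs at hy with hd
    · obtain ⟨θ, hθ, rfl⟩ := hy
      rw [hf]
      have := hM.rho_mem hρ hθ hx
      rwa [Nat.add_sub_cancel' hd] at this
    · rw [(Submodule.mem_bot F₂).1 hy, map_zero]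
      exact Submodule.zero_mem _

/-- Induction over the elements of the free unstable module on one generator. -/
theorem freeUnstable_mem (S : Submodule F₂ (freeUnstableModule n).carrier)
    (h1 : fundamentalClass n ∈ S) (hS : ∀ i, ∀ y ∈ S, (freeUnstableModule n).sq i y ∈ S)
    (y : (freeUnstableModule n).carrier) : y ∈ S := by
  -- The right factor `θ` is kept general so that the product case is the composite of the two
  -- hypotheses.
  have key : ∀ (a : FreeAlgebra F₂ ℕ+) (θ : SteenrodAlgebra), freeUnstableProj n θ ∈ S →
      freeUnstableProj n (RingQuot.mkAlgHom F₂ AdemRel a * θ) ∈ S := by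
    intro a
    induction a using FreeAlgebra.induction with
    | grade0 r =>
      intro θ hθ
      rw [AlgHom.commutes, ← Algebra.smul_def, map_smul]
      exact S.smul_mem r hθ
    | grade1 i =>
      intro θ hθ
      have := hS i _ hθ
      rw [sq_freeUnstableProj, SteenrodAlgebra.Sq, freeSq, dif_pos i.pos] at this
      exact this
    | mul a b ha hb =>
      intro θ hθ
      rw [map_mul (RingQuot.mkAlgHom F₂ AdemRel), mul_assoc]
      exact ha _ (hb _ hθ)
    | add a b ha hb =>
      intro θ hθ
      rw [map_add, add_mul, map_add]
      exact S.add_mem (ha _ hθ) (hb _ hθ)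
  obtain ⟨θ, rfl⟩ := freeUnstableProj_surjective y
  obtain ⟨a, rfl⟩ := RingQuot.mkAlgHom_surjective F₂ AdemRel θ
  simpa only [mul_one] using key a 1 (freeUnstableProj_one (n := n) ▸ h1)

end FreeUnstable

/-! ### The free star-unstable algebra -/

namespace SymmOperad

open Finset SqAlgebra

variable {P : SymmOperad} {star : P.obj 2} {M : SqSpace}

theorem freeStarUnstable_isAlgebra : (P.freeStarUnstable star M).IsAlgebra :=
  (P.schurAlgebra_isAlgebra M).quotient _ _

theorem freeStarUnstable_cartan :
    (P.freeStarUnstable star M).Cartan (P.freeStarUnstable star M).sq :=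
  Cartan.quotient (schurAlgebra_cartan M) _ _

variable (P star M) in
/-- The projection from `S(P, M)` to `K_P^⋆(M)`. -/
def freeStarUnstableProj :
    (P.schurAlgebra M).carrier →ₗ[F₂] (P.freeStarUnstable star M).carrier :=
  ((P.schurAlgebra M).idealSpan (P.unstableRelations star M)).mkQ

theorem freeStarUnstableProj_surjective : Function.Surjective (P.freeStarUnstableProj star M) :=
  Submodule.mkQ_surjective _

theorem freeStarUnstableProj_op {n : ℕ} (μ : P.obj n) (x : Fin n → (P.schurAlgebra M).carrier) :
    P.freeStarUnstableProj star M ((P.schurAlgebra M).op μ x) =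
      (P.freeStarUnstable star M).op μ fun j => P.freeStarUnstableProj star M (x j) :=
  (quotient_op _ _ μ x).symm

theorem freeStarUnstableProj_sq (i : ℕ) (x : (P.schurAlgebra M).carrier) :
    P.freeStarUnstableProj star M ((P.schurAlgebra M).sq i x) =
      (P.freeStarUnstable star M).sq i (P.freeStarUnstableProj star M x) :=
  rfl

theorem freeStarUnstableProj_mono {n : ℕ} (μ : P.obj n) (v : Fin n → M.carrier) :
    P.freeStarUnstableProj star M (P.mono μ v) =
      (P.freeStarUnstable star M).op μ fun j => P.freeStarUnstableUnit star M (v j) := by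
  rw [mono_eq_schurOp]
  exact freeStarUnstableProj_op μ _

theorem schurSq_unit (i : ℕ) (y : M.carrier) :
    P.schurSq M.sq i (P.mono P.one fun _ => y) = P.mono P.one fun _ => M.sq i y := by
  rw [schurSq_mono, sum_piAntidiag_fin_one]

theorem sq_freeStarUnstableUnit (i : ℕ) (y : M.carrier) :
    (P.freeStarUnstable star M).sq i (P.freeStarUnstableUnit star M y) =
      P.freeStarUnstableUnit star M (M.sq i y) :=
  (freeStarUnstableProj_sq i _).symm.trans
    (congrArg (P.freeStarUnstableProj star M) (schurSq_unit i y))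

theorem mono_one_mem {d : ℕ} {y : M.carrier} (hy : y ∈ M.deg d) :
    (P.mono P.one fun _ => y) ∈ P.schurDeg M.deg d :=
  Submodule.subset_span ⟨1, P.one, fun _ => y, fun _ => d, fun _ => hy, by simp, rfl⟩

theorem freeStarUnstableUnit_mem {d : ℕ} {y : M.carrier} (hy : y ∈ M.deg d) :
    P.freeStarUnstableUnit star M y ∈ (P.freeStarUnstable star M).deg d :=
  ⟨_, mono_one_mem hy, rfl⟩

/-- This is the defining relation of the quotient for `t = (1; y)`. It supplies the value of `Sq¹`
on `ι₁`. -/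
theorem sq_top_freeStarUnstableUnit {d : ℕ} {y : M.carrier} (hy : y ∈ M.deg d) :
    (P.freeStarUnstable star M).sq d (P.freeStarUnstableUnit star M y) =
      (P.freeStarUnstable star M).op star
        ![P.freeStarUnstableUnit star M y, P.freeStarUnstableUnit star M y] := by
  let t : (P.schurAlgebra M).carrier := P.mono P.one fun _ => y
  have ht : t ∈ (P.schurAlgebra M).deg d := mono_one_mem hy
  have hrel : P.freeStarUnstableProj star M
      ((P.schurAlgebra M).sq d t + (P.schurAlgebra M).op star ![t, t]) = 0 := by
    refine (Submodule.Quotient.mk_eq_zero _).2 (Submodule.mem_sInf.2 fun I hI => ?_)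
    exact hI.2 ⟨d, t, ht, rfl⟩
  rw [map_add, freeStarUnstableProj_op, freeStarUnstableProj_sq] at hrel
  have hneg : ∀ a b : (P.freeStarUnstable star M).carrier, a + b = 0 → a = b := by
    intro a b hab
    have h2 : b + b = 0 := by rw [← two_smul F₂, show (2 : F₂) = 0 from rfl, zero_smul]
    exact add_right_cancel (hab.trans h2.symm)
  refine (hneg _ _ hrel).trans ?_
  congr 1
  funext j; fin_cases j <;> rfl

/-! ### The universal property of the free `⋆`-unstable algebra. -/

section Universal

variable {A : SqAlgebra P}

/-- The morphism of algebras from `S(P, M)` that extends a linear map from `M`. -/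
def schurHom (hA : A.IsAlgebra) (f : M.carrier →ₗ[F₂] A.carrier) :
    (P.schurAlgebra M).carrier →ₗ[F₂] A.carrier :=
  homExt hA f

theorem schurHom_op (hA : A.IsAlgebra) (f : M.carrier →ₗ[F₂] A.carrier) {n : ℕ} (μ : P.obj n)
    (x : Fin n → (P.schurAlgebra M).carrier) :
    schurHom hA f ((P.schurAlgebra M).op μ x) = A.op μ fun j => schurHom hA f (x j) :=
  homExt_op hA f μ x

/-- Both composites satisfy the Cartan formula and agree on generators. -/
theorem schurHom_sq (hA : A.IsAlgebra) (hA' : A.Cartan A.sq) (f : M.carrier →ₗ[F₂] A.carrier)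
    (hsq : ∀ i y, f (M.sq i y) = A.sq i (f y)) (i : ℕ) (x : (P.schurAlgebra M).carrier) :
    schurHom hA f ((P.schurAlgebra M).sq i x) = A.sq i (schurHom hA f x) := by
  have key := CartanFamily.ext (g := fun i => homExt hA f ∘ₗ P.schurSq M.sq i)
    (h := fun i => A.sq i ∘ₗ homExt hA f)
    (CartanFamily.hom_comp (schurAlgebra_cartan (P := P) M) (homExt_op hA f))
    (CartanFamily.comp_hom hA' (homExt_op hA f)) fun i v => by
      rw [LinearMap.comp_apply, LinearMap.comp_apply, homExt_one, ← hsq, schurSq_unit, homExt_one]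
  exact LinearMap.congr_fun (congrFun key i) x

/-- The kernel is itself a `P`-ideal stable under the squares, and it contains the relations since
`Sq₀ x = ⋆(x, x)` in `A`; minimality of the ideal does the rest. -/
theorem idealSpan_le_ker_schurHom (hA : A.IsStarUnstable star) (f : M.carrier →ₗ[F₂] A.carrier)
    (hsq : ∀ i y, f (M.sq i y) = A.sq i (f y)) (hdeg : ∀ d, ∀ y ∈ M.deg d, f y ∈ A.deg d) :
    (P.schurAlgebra M).idealSpan (P.unstableRelations star M) ≤
      LinearMap.ker (schurHom hA.isAlgebra f) := by
  refine sInf_le ⟨⟨?_, ?_⟩, ?_⟩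
  · intro n μ x i hi
    rw [LinearMap.mem_ker, schurHom_op]
    exact MultilinearMap.map_coord_zero _ i hi
  · intro i x hx
    rw [LinearMap.mem_ker] at hx ⊢
    rw [schurHom_sq hA.isAlgebra hA.cartan f hsq, hx, map_zero]
  · rintro _ ⟨d, t, ht, rfl⟩
    have hpair : (fun j => schurHom hA.isAlgebra f
        ((![t, t] : Fin 2 → (P.schurAlgebra M).carrier) j)) =
        ![schurHom hA.isAlgebra f t, schurHom hA.isAlgebra f t] := by
      funext j; fin_cases j <;> rfl
    have ht' : schurHom hA.isAlgebra f t ∈ A.deg d :=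
      homExt_mem_deg hA.isAlgebra M.deg f hdeg d t ht
    rw [SetLike.mem_coe, LinearMap.mem_ker, map_add, schurHom_sq hA.isAlgebra hA.cartan f hsq,
      schurHom_op, hpair, hA.sq_top d _ ht', ← two_smul F₂, show (2 : F₂) = 0 from rfl, zero_smul]

/-- A morphism of unstable modules from `M` to a star-unstable algebra extends to `K_P^⋆(M)`. -/
theorem exists_freeStarUnstable_lift (hA : A.IsStarUnstable star)
    (f : M.carrier →ₗ[F₂] A.carrier) (hsq : ∀ i y, f (M.sq i y) = A.sq i (f y))
    (hdeg : ∀ d, ∀ y ∈ M.deg d, f y ∈ A.deg d) :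
    ∃ ψ : (P.freeStarUnstable star M).carrier →ₗ[F₂] A.carrier,
      (∀ {n : ℕ} (μ : P.obj n) x, ψ ((P.freeStarUnstable star M).op μ x) =
        A.op μ fun j => ψ (x j)) ∧
      (∀ y, ψ (P.freeStarUnstableUnit star M y) = f y) ∧
      ∀ d, ∀ x ∈ (P.freeStarUnstable star M).deg d, ψ x ∈ A.deg d := by
  let ψ : (P.freeStarUnstable star M).carrier →ₗ[F₂] A.carrier :=
    Submodule.liftQ _ (schurHom hA.isAlgebra f) (idealSpan_le_ker_schurHom hA f hsq hdeg)
  have hψ : ∀ t, ψ (P.freeStarUnstableProj star M t) = schurHom hA.isAlgebra f t := fun t => rfl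
  refine ⟨ψ, ?_, ?_, ?_⟩
  · intro n μ x
    choose t ht using fun j => freeStarUnstableProj_surjective (x j)
    obtain rfl : (fun j => P.freeStarUnstableProj star M (t j)) = x := funext ht
    rw [← freeStarUnstableProj_op, hψ, schurHom_op]
    rfl
  · exact fun y => homExt_one hA.isAlgebra f y
  · rintro d _ ⟨t, ht, rfl⟩
    exact homExt_mem_deg hA.isAlgebra M.deg f hdeg d t ht

end Universal

/-! ### Comparison of the model with `K_P^⋆(F(1))`. -/

section Line

/-- The generator of `K_P^⋆(F(1))`. -/
abbrev starUnstableClass (P : SymmOperad) (star : P.obj 2) :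
    (P.freeStarUnstable star (freeUnstableModule 1)).carrier :=
  P.freeStarUnstableUnit star (freeUnstableModule 1) (fundamentalClass 1)

theorem freeUnstable_sq_zero (n : ℕ) (y : (freeUnstableModule n).carrier) :
    (freeUnstableModule n).sq 0 y = y := by
  obtain ⟨θ, rfl⟩ := freeUnstableProj_surjective y
  rw [sq_freeUnstableProj]
  simp [SteenrodAlgebra.Sq, freeSq]

theorem freeUnstable_sq_eq_zero {n i : ℕ} (hi : n < i) :
    (freeUnstableModule n).sq i (fundamentalClass n) = 0 := by
  rw [← freeUnstableProj_one, sq_freeUnstableProj]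
  refine (Submodule.Quotient.mk_eq_zero (excessIdeal n)).2 (Submodule.subset_span
    ⟨i, 0, 1, Submodule.subset_span ⟨[], by simp, by simp⟩, by simpa using hi, rfl⟩)

theorem fundamentalClass_mem (n : ℕ) : fundamentalClass n ∈ (freeUnstableModule n).deg n := by
  rw [mem_freeUnstableModule_deg, if_pos le_rfl, Nat.sub_self]
  exact ⟨1, Submodule.subset_span ⟨[], by simp, by simp⟩, rfl⟩

theorem sq_zero_starUnstableClass :
    (P.freeStarUnstable star (freeUnstableModule 1)).sq 0 (starUnstableClass P star) =
      starUnstableClass P star := by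
  rw [sq_freeStarUnstableUnit, freeUnstable_sq_zero]

theorem sq_starUnstableClass_of_two_le {j : ℕ} (hj : 2 ≤ j) :
    (P.freeStarUnstable star (freeUnstableModule 1)).sq j (starUnstableClass P star) = 0 := by
  rw [sq_freeStarUnstableUnit, freeUnstable_sq_eq_zero hj]
  exact (congrArg (P.freeStarUnstableProj star _)
    (map_zero (unitₗ P (freeUnstableModule 1).carrier))).trans (map_zero _)

variable {A : SqAlgebra P} {ι : A.carrier}
  {φ : A.carrier →ₗ[F₂] (P.freeStarUnstable star (freeUnstableModule 1)).carrier}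

theorem map_sq_generator (hA : A.IsGeneratedByLine star ι)
    (hop : ∀ {n : ℕ} (μ : P.obj n) x,
      φ (A.op μ x) = (P.freeStarUnstable star (freeUnstableModule 1)).op μ fun j => φ (x j))
    (hι : φ ι = starUnstableClass P star) (i : ℕ) :
    φ (A.sq i ι) = (P.freeStarUnstable star (freeUnstableModule 1)).sq i (φ ι) := by
  rw [hι]
  match i with
  | 0 => rw [hA.sq_zero, hι, sq_zero_starUnstableClass]
  | 1 =>
    rw [hA.sq_one, hop, sq_top_freeStarUnstableUnit (fundamentalClass_mem 1)]
    congr 1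
    funext j; fin_cases j <;> exact hι
  | i + 2 =>
    rw [hA.sq_of_two_le _ (by omega), sq_starUnstableClass_of_two_le (by omega), map_zero]

/-- The range of `φ` is closed under the operations and the squares and contains `ι₁`. It thus
contains the image of `F(1)`, which generates `K_P^⋆(F(1))` as an algebra. -/
theorem hom_surjective (hA : A.IsGeneratedByLine star ι)
    (hop : ∀ {n : ℕ} (μ : P.obj n) x,
      φ (A.op μ x) = (P.freeStarUnstable star (freeUnstableModule 1)).op μ fun j => φ (x j))
    (hι : φ ι = starUnstableClass P star) : Function.Surjective φ := by
  have hsq := hA.map_sq freeStarUnstable_cartan φ hop (map_sq_generator hA hop hι)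
  have hunit : ∀ y, P.freeStarUnstableUnit star (freeUnstableModule 1) y ∈ LinearMap.range φ := by
    intro y
    refine freeUnstable_mem ((LinearMap.range φ).comap (P.freeStarUnstableProj star _ ∘ₗ
      (unitₗ P (freeUnstableModule 1).carrier :
        _ →ₗ[F₂] (P.schurAlgebra (freeUnstableModule 1)).carrier))) ⟨ι, hι⟩ ?_ y
    rintro i y ⟨a, ha⟩
    refine ⟨A.sq i a, ?_⟩
    rw [hsq, ha]
    exact sq_freeStarUnstableUnit i y
  intro x
  obtain ⟨t, rfl⟩ := freeStarUnstableProj_surjective x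
  change P.freeStarUnstableProj star _ t ∈ LinearMap.range φ
  refine schur_induction (C := fun t => P.freeStarUnstableProj star (freeUnstableModule 1) t ∈
    LinearMap.range φ) t ?_ ?_ ?_
  · exact ⟨0, (map_zero _).trans (map_zero (P.freeStarUnstableProj star _)).symm⟩
  · intro x y hx hy
    exact Submodule.add_mem _ hx hy
  · intro n μ v
    choose a ha using fun j => hunit (v j)
    exact ⟨A.op μ a, by rw [freeStarUnstableProj_mono, hop]; simp only [ha]⟩

/-- This is where `⋆`-unstability of `A` pays off: `ι` defines a map `F(1) → A`, which extends to
`K_P^⋆(F(1))`. Injectivity of `φ` says that the quotient imposes no further relations on `ι₁`. -/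
theorem hom_leftInverse (hcomm : P.IsCommutative star) (hcentral : P.IsCentral star)
    (hA : A.IsGeneratedByLine star ι)
    (hop : ∀ {n : ℕ} (μ : P.obj n) x,
      φ (A.op μ x) = (P.freeStarUnstable star (freeUnstableModule 1)).op μ fun j => φ (x j))
    (hι : φ ι = starUnstableClass P star) :
    ∃ ψ : (P.freeStarUnstable star (freeUnstableModule 1)).carrier →ₗ[F₂] A.carrier,
      (∀ x, ψ (φ x) = x) ∧
      ∀ d, ∀ x ∈ (P.freeStarUnstable star (freeUnstableModule 1)).deg d, ψ x ∈ A.deg d := by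
  have hS := hA.isStarUnstable hcomm hcentral
  have hmem : ι ∈ A.deg 1 :=
    (hA.mem_deg 1 ι).2 ⟨P.one, (hA.isAlgebra.op_one fun _ => ι).symm⟩
  obtain ⟨f, hf, hfsq, hfdeg⟩ := hS.isUnstable.exists_freeUnstable_lift hmem
  obtain ⟨ψ, hψop, hψ, hψdeg⟩ := exists_freeStarUnstable_lift hS f hfsq hfdeg
  refine ⟨ψ, fun x => ?_, hψdeg⟩
  refine LinearMap.congr_fun (f := ψ ∘ₗ φ) (g := LinearMap.id) (hA.hom_ext fun n μ => ?_) x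
  rw [LinearMap.comp_apply, hop, hψop]
  simp only [hι, hψ, hf]
  rfl

/-- A morphism from a free algebra on a class of degree one to `K_P^⋆(F(1))` that preserves the
generators is an isomorphism of graded algebras. -/
theorem exists_equiv (hcomm : P.IsCommutative star) (hcentral : P.IsCentral star)
    (hA : A.IsGeneratedByLine star ι)
    (hop : ∀ {n : ℕ} (μ : P.obj n) x,
      φ (A.op μ x) = (P.freeStarUnstable star (freeUnstableModule 1)).op μ fun j => φ (x j))
    (hι : φ ι = starUnstableClass P star) :
    ∃ Φ : A.carrier ≃ₗ[F₂] (P.freeStarUnstable star (freeUnstableModule 1)).carrier,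
      (∀ x, Φ x = φ x) ∧
      ∀ d, (A.deg d).map Φ.toLinearMap =
        (P.freeStarUnstable star (freeUnstableModule 1)).deg d := by
  obtain ⟨ψ, hψ, hψdeg⟩ := hom_leftInverse hcomm hcentral hA hop hι
  have hsurj := hom_surjective hA hop hι
  refine ⟨LinearEquiv.ofBijective φ ⟨Function.LeftInverse.injective hψ, hsurj⟩, fun _ => rfl,
    fun d => le_antisymm ?_ ?_⟩
  · rintro _ ⟨x, hx, rfl⟩
    obtain ⟨μ, rfl⟩ := (hA.mem_deg d x).1 hx
    change φ _ ∈ _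
    rw [hop]
    have := (freeStarUnstable_isAlgebra (P := P) (star := star)).op_mem μ (fun _ => 1)
      (fun _ => φ ι) fun _ => by
        rw [hι]; exact freeStarUnstableUnit_mem (fundamentalClass_mem 1)
    simpa using this
  -- Since `ψ` preserves degrees and inverts `φ`, every homogeneous element has a preimage of the
  -- same degree.
  · intro x hx
    refine ⟨ψ x, hψdeg d x hx, ?_⟩
    obtain ⟨y, rfl⟩ := hsurj x
    exact congrArg φ (hψ y)

end Line

end SymmOperad

end

theorem mainTheorem2 (P : SymmOperad) (star : P.obj 2) (hcomm : P.IsCommutative star)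
    (hcentral : P.IsCentral star) :
    let K : SqAlgebra P := P.freeStarUnstable star (freeUnstableModule 1)
    let ι₁ : K.carrier :=
      P.freeStarUnstableUnit star (freeUnstableModule 1) (fundamentalClass 1)
    K.IsStarUnstable star ∧
    (∃ φ : P.Schur F₂ ≃ₗ[F₂] K.carrier,
      (∀ (n : ℕ) (μ : P.obj n) (x : Fin n → P.Schur F₂),
        φ (P.schurOp F₂ μ x) = K.op μ fun i => φ (x i)) ∧
      (∀ d : ℕ, (P.schurDeg lineDeg d).map φ.toLinearMap = K.deg d) ∧
      φ (P.mono P.one fun _ => 1) = ι₁) ∧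
    (K.sq 0 ι₁ = ι₁ ∧ K.sq 1 ι₁ = K.op star ![ι₁, ι₁] ∧ ∀ j : ℕ, 2 ≤ j → K.sq j ι₁ = 0) ∧
    (∀ sq : ℕ → Module.End F₂ K.carrier, K.Cartan sq →
      sq 0 ι₁ = ι₁ → sq 1 ι₁ = K.op star ![ι₁, ι₁] → (∀ j : ℕ, 2 ≤ j → sq j ι₁ = 0) →
      sq = K.sq) := by
  intro K ι₁
  let A := SymmOperad.lineAlgebra star
  have hA : A.IsGeneratedByLine star (SymmOperad.lineClass P) :=
    SymmOperad.lineAlgebra_isGeneratedByLine star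
  let φ : A.carrier →ₗ[F₂] K.carrier :=
    SqAlgebra.homExt SymmOperad.freeStarUnstable_isAlgebra
      (LinearMap.toSpanSingleton F₂ K.carrier ι₁)
  have hop : ∀ {n : ℕ} (μ : P.obj n) x, φ (A.op μ x) = K.op μ fun j => φ (x j) :=
    fun μ x => SqAlgebra.homExt_op SymmOperad.freeStarUnstable_isAlgebra _ μ x
  have hι : φ (SymmOperad.lineClass P) = ι₁ :=
    (SqAlgebra.homExt_one SymmOperad.freeStarUnstable_isAlgebra _ (1 : F₂)).trans (one_smul F₂ _)
  obtain ⟨Φ, hΦ, hdeg⟩ := SymmOperad.exists_equiv hcomm hcentral hA hop hι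
  have hΦop : ∀ {n : ℕ} (μ : P.obj n) x, Φ (A.op μ x) = K.op μ fun j => Φ (x j) := by
    intro n μ x
    simp only [hΦ, hop]
  have hΦι : Φ (SymmOperad.lineClass P) = ι₁ := (hΦ _).trans hι
  have hK : K.IsGeneratedByLine star ι₁ := by
    rw [← hΦι]
    refine hA.of_equiv SymmOperad.freeStarUnstable_isAlgebra SymmOperad.freeStarUnstable_cartan Φ
      hΦop ?_ hdeg
    intro i
    exact (hΦ _).trans ((SymmOperad.map_sq_generator hA hop hι i).trans (congrArg _ (hΦ _).symm))
  refine ⟨hK.isStarUnstable hcomm hcentral, ⟨Φ, fun n μ x => hΦop μ x, hdeg, hΦι⟩,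
    ⟨hK.sq_zero, hK.sq_one, hK.sq_of_two_le⟩, fun sq hsq h0 h1 h2 => ?_⟩
  funext i
  refine LinearMap.ext fun x => ?_
  -- Uniqueness is the case of the identity map, with `K.sq` on the source and `sq` on the target.
  refine (hK.map_sq hsq LinearMap.id (fun _ _ => rfl) (fun i => ?_) i x).symm
  change K.sq i ι₁ = sq i ι₁
  match i with
  | 0 => rw [hK.sq_zero, h0]
  | 1 => rw [hK.sq_one, h1]
  | i + 2 => rw [hK.sq_of_two_le _ (by omega), h2 _ (by omega)]
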